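/- **Setting.** Partially ordered vector spaces are real, with a proper cone $E^+$. Such a space $E$ is *monotone complete* if every increasing net in $E$ that is bounded above has a supremum, and has the *countable sup property* if, whenever $0\le x_\lambda\uparrow x$ for a net in $E$, there are at most countably many indices $\lambda_n$ with $x=\sup_n x_{\lambda_n}$. For a non-empty $S\subseteq E$, let $S^{\Uparrow}$ (resp. $S^{\uparrow}$) be the set of all suprema in $E$ of increasing nets (resp. sequences) in $S$ that have a supremum, and define $S^{\Downarrow}$, $S^{\downarrow}$ similarly with infima of decreasing nets (resp. sequences). Successive arrows are applied from left to right, e.g. $S^{\Uparrow\Downarrow\uparrow}=((S^{\Uparrow})^{\Downarrow})^{\uparrow}$. Let $X$ be a locally compact Hausdorff space with Borel $\sigma$-algebra $\mathscr B$, and let $E$ be a monotone complete partially ordered vector space. A *finite measure* $\mu:\mathscr B\to E^+$ is a map with $\mu(\emptyset)=0$ and $\mu(\bigcup_n A_n)=\bigvee_N\sum_{n=1}^N\mu(A_n)$ for pairwise disjoint $A_n\in\mathscr B$. For an elementary function $\varphi=\sum_i r_i\mathbf 1_{A_i}\ge 0$ with disjoint $A_i\in\mathscr B$, put $\int\varphi\,d\mu=\sum_i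 r_i\mu(A_i)$; for measurable $f:X\to[0,\infty]$, put $\int f\,d\mu=\bigvee_n\int\varphi_n\,d\mu$ in $E\cup\{\infty\}$, where $(\varphi_n)$ is any sequence of elementary functions increasing pointwise to $f$. Let $\mathcal L^1(\mu)$ be the set of measurable $f:X\to\mathbb R$ with $\int|f|\,d\mu\in E$, ordered pointwise, and let $I_\mu(f)=\int f^+\,d\mu-\int f^-\,d\mu$ for $f\in\mathcal L^1(\mu)$. Let $\mathcal B(X)$ be the set of bounded Borel measurable functions $X\to\mathbb R$, and let $\mathrm L^1(\mu)$ and $\mathrm B(\mu)$ denote the sets of $\mu$-almost everywhere classes of elements of $\mathcal L^1(\mu)$ and of $\mathcal B(X)$. The operator $I_\mu:\mathcal L^1(\mu)\to E$ *preserves the lattice structure* if, for all $f,g\in\mathcal L^1(\mu)$, the supremum $I_\mu(f)\vee I_\mu(g)$ exists in $E$ and equals $I_\mu(f\vee g)$. For $f\in C_c(X)$ with $0\le f\le 1$, write $f\prec V$ if $\operatorname{supp} f\subseteq V$, and $K\prec f$ if $f=1$ on $K$. The measure $\mu$ is *inner regular at* $A$ if $\mu(A)=\bigvee\{\mu(K):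 K\subseteq A\text{ compact}\}$, and *outer regular at* $A$ if $\mu(A)=\bigwedge\{\mu(V): V\supseteq A\text{ open}\}$. **Theorem (Ups and downs for vector lattices).** Let $T:C_c(X)\to E$ be a positive linear operator (where $C_c(X)$ consists of real-valued functions). Suppose that $\mu:\mathscr B\to E^+$ is a finite measure that is outer regular at all Borel sets and inner regular at all Borel sets, that represents $T$, i.e. $C_c(X)\subseteq\mathcal L^1(\mu)$ and $T(f)=I_\mu(f)$ for $f\in C_c(X)$, and that satisfies $$\mu(V)=\bigvee\{T(f): f\prec V\}\quad\text{for all open } V\subseteq X,\qquad \mu(K)=\bigwedge\{T(f): K\prec f\}\quad\text{for all compact } K\subseteq X.$$ Then $\mathcal B(X)\subseteq\mathcal L^1(\mu)$. Extend $T$ to $\mathcal L^1(\mu)$ by $T(f):=I_\mu(f)$. Then: 1. $T(\mathcal B(X))$ is contained in each of the four sets $[T(C_c(X))]^{\Uparrow\Downarrow\uparrow}$, $[T(C_c(X))]^{\Downarrow\Uparrow\downarrow}$, $[T(C_c(X))]^{\Downarrow\Uparrow\uparrow}$, $[T(C_c(X))]^{\Uparrow\Downarrow\downarrow}$. 2.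 If $E$ has the countable sup property and $I_\mu:\mathcal L^1(\mu)\to E$ preserves the lattice structure, then $T(\mathcal B(X))\subseteq[T(C_c(X))]^{\downarrow\uparrow}$ and $T(\mathcal B(X))\subseteq[T(C_c(X))]^{\uparrow\downarrow}$. 3. If, moreover, $\mathrm L^1(\mu)=\mathrm B(\mu)$, then $T(\mathcal B(X))=[T(C_c(X))]^{\downarrow\uparrow}=[T(C_c(X))]^{\uparrow\downarrow}$. -/

import Mathlib

open Set MeasureTheory
open scoped ENNReal NNReal CompactlySupported

namespace UpsAndDowns

noncomputable section

/-! ## Order-theoretic notions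

An increasing net `x_l ↑ x` enters only through its range, which is a non-empty upward directed
set with supremum `x`; conversely a non-empty upward directed set is an increasing net indexed by
itself. Nets are therefore expressed by directed sets. -/

/-- Monotone completeness: every increasing net that is bounded from above has a supremum. -/
def MonotoneComplete (E : Type*) [PartialOrder E] : Prop :=
  ∀ D : Set E, D.Nonempty → DirectedOn (· ≤ ·) D → BddAbove D → ∃ x, IsLUB D x

/-- The countable sup property: every increasing net in the positive cone with a supremum has an
at most countable family of terms with the same supremum. -/
def CountableSupProperty (E : Type*) [PartialOrder E] [Zero E] : Prop :=
  ∀ (D : Set E) (x : E), D.Nonempty → DirectedOn (· ≤ ·) D → (∀ d ∈ D, 0 ≤ d) → IsLUB D x →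
    ∃ C : Set E, C ⊆ D ∧ C.Nonempty ∧ C.Countable ∧ IsLUB C x

section Ups

variable {E : Type*} [PartialOrder E]

/-- Suprema of increasing nets in `S`. -/
def netUp (S : Set E) : Set E :=
  {x | ∃ D : Set E, D ⊆ S ∧ D.Nonempty ∧ DirectedOn (· ≤ ·) D ∧ IsLUB D x}

/-- Infima of decreasing nets in `S`. -/
def netDown (S : Set E) : Set E :=
  {x | ∃ D : Set E, D ⊆ S ∧ D.Nonempty ∧ DirectedOn (· ≥ ·) D ∧ IsGLB D x}

/-- Suprema of increasing sequences in `S`. -/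
def seqUp (S : Set E) : Set E :=
  {x | ∃ u : ℕ → E, (∀ n, u n ∈ S) ∧ Monotone u ∧ IsLUB (range u) x}

/-- Infima of decreasing sequences in `S`. -/
def seqDown (S : Set E) : Set E :=
  {x | ∃ u : ℕ → E, (∀ n, u n ∈ S) ∧ Antitone u ∧ IsGLB (range u) x}

end Ups

/-- `T` preserves the lattice structure: whenever `x ∨ y` exists, `T x ∨ T y` exists and equals
`T (x ∨ y)`. -/
def PreservesLatticeStructure {F E : Type*} [PartialOrder F] [PartialOrder E] (T : F → E) : Prop :=
  ∀ x y z : F, IsLUB {x, y} z → IsLUB {T x, T y} (T z)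

/-! ## Finite measures with values in the positive cone, and the order integral -/

/-- A finite measure with values in the positive cone of `E`. Only the values on measurable sets
are relevant. -/
structure FinitePosMeasure (X E : Type*) [MeasurableSpace X] [AddCommGroup E] [PartialOrder E] where
  toFun : Set X → E
  nonneg : ∀ A, MeasurableSet A → 0 ≤ toFun A
  empty : toFun ∅ = 0
  sigma_additive : ∀ A : ℕ → Set X, (∀ n, MeasurableSet (A n)) →
    Pairwise (fun m n => Disjoint (A m) (A n)) →
      IsLUB (range fun N : ℕ => ∑ n ∈ Finset.range N, toFun (A n)) (toFun (⋃ n, A n))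

section Integral

variable {X E : Type*} [MeasurableSpace X] [AddCommGroup E] [PartialOrder E] [Module ℝ E]

/-- The integral of an elementary function, in its canonical disjoint representation. -/
def elementaryIntegral (μ : FinitePosMeasure X E) (φ : SimpleFunc X ℝ≥0) : E :=
  ∑ r ∈ φ.range, (r : ℝ) • μ.toFun (φ ⁻¹' {r})

/-- `a`, in `E ∪ {∞}`, is the supremum of the integrals of a sequence of elementary functions that
increases pointwise to `f`. -/
def HasOrderIntegral (μ : FinitePosMeasure X E) (f : X → ℝ≥0∞) (a : WithTop E) : Prop :=
  ∃ φ : ℕ → SimpleFunc X ℝ≥0, Monotone φ ∧ (∀ x, ⨆ n, (φ n x : ℝ≥0∞) = f x) ∧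
    IsLUB (range fun n => ((elementaryIntegral μ (φ n) : E) : WithTop E)) a

open Classical in
/-- The order integral of a measurable `f : X → [0, ∞]` (set to `∞` when no approximating sequence
as above with a supremum of integrals exists). -/
def orderIntegral (μ : FinitePosMeasure X E) (f : X → ℝ≥0∞) : WithTop E :=
  if h : ∃ a, HasOrderIntegral μ f a then h.choose else ⊤

/-- The (finite valued) measurable functions whose absolute value has a finite integral. -/
def L1 (μ : FinitePosMeasure X E) : Set (X → ℝ) :=
  {f | Measurable f ∧ orderIntegral μ (fun x => ENNReal.ofReal |f x|) ≠ ⊤}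

/-- The integral of an integrable function, through its positive and negative parts. -/
def integral (μ : FinitePosMeasure X E) (f : X → ℝ) : E :=
  (orderIntegral μ fun x => ENNReal.ofReal (f x)).untopD 0
    - (orderIntegral μ fun x => ENNReal.ofReal (-f x)).untopD 0

/-- The integral operator on the space of integrable functions (with the pointwise ordering). -/
def integralOperator (μ : FinitePosMeasure X E) : L1 μ → E := fun f => integral μ f

/-- The bounded measurable functions. -/
def boundedMeasurable (X : Type*) [MeasurableSpace X] : Set (X → ℝ) :=
  {f | Measurable f ∧ ∃ M : ℝ, ∀ x, |f x| ≤ M}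

/-- The class of `f` modulo equality almost everywhere. -/
def aeClass (μ : FinitePosMeasure X E) (f : X → ℝ) : Set (X → ℝ) :=
  {g | Measurable g ∧ μ.toFun {x | f x ≠ g x} = 0}

/-- The spaces of almost everywhere classes of integrable functions and of bounded measurable
functions coincide. -/
def L1EqBounded (μ : FinitePosMeasure X E) : Prop :=
  aeClass μ '' L1 μ = aeClass μ '' boundedMeasurable X

end Integral

section Regularity

variable {X E : Type*} [TopologicalSpace X] [MeasurableSpace X] [AddCommGroup E] [PartialOrder E]

def InnerRegularAt (μ : FinitePosMeasure X E) (A : Set X) : Prop :=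
  IsLUB (μ.toFun '' {K | IsCompact K ∧ K ⊆ A}) (μ.toFun A)

def OuterRegularAt (μ : FinitePosMeasure X E) (A : Set X) : Prop :=
  IsGLB (μ.toFun '' {V | IsOpen V ∧ A ⊆ V}) (μ.toFun A)

/-- A regular Borel measure: inner regular at open sets and outer regular at Borel sets. (That
compact sets have finite measure is automatic here.) -/
def RegularBorel (μ : FinitePosMeasure X E) : Prop :=
  (∀ V, IsOpen V → InnerRegularAt μ V) ∧ (∀ A, MeasurableSet A → OuterRegularAt μ A)

/-- `f ≺ V`. -/
def SubordinateTo (f : C_c(X, ℝ)) (V : Set X) : Prop :=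
  (∀ x, 0 ≤ f x ∧ f x ≤ 1) ∧ tsupport f ⊆ V

/-- `K ≺ f`. -/
def Dominates (K : Set X) (f : C_c(X, ℝ)) : Prop :=
  (∀ x, 0 ≤ f x ∧ f x ≤ 1) ∧ ∀ x ∈ K, f x = 1

/-- `μ` represents `T`: compactly supported continuous functions are integrable and `T` is given
by integration. -/
def Represents [Module ℝ E] (μ : FinitePosMeasure X E) (T : C_c(X, ℝ) →ₗ[ℝ] E) : Prop :=
  ∀ f : C_c(X, ℝ), ⇑f ∈ L1 μ ∧ T f = integral μ f

end Regularity

end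

end UpsAndDowns

namespace UpsAndDowns

set_option linter.unusedSectionVars false

/-! ### Order limits in partially ordered vector spaces and the Archimedean property. -/

section Order

variable {E : Type*} [AddCommGroup E] [PartialOrder E] [IsOrderedAddMonoid E]

/-! A bounded measurable `f`, shifted by a constant `M`, is the increasing limit of elementary
functions, so by monotone convergence its integral is the supremum of an increasing sequence of
values `∑ r • μ(A) - M • μ(X)`. It remains to reach such values from the range of `T`. Since `E`
carries no norm and need not be a lattice, monotone convergence is proved from order alone: a
monotone complete space is Archimedean, and this drives `elementaryIntegral_le_of_le_iSup`.

For arbitrary `E`, outer regularity together with the formula for open sets places every `μ(A)` in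
the down-up set of the range of `T` (net suprema first, then net infima), and inner regularity with
the formula for compact sets places it in the up-down set. Both sets are convex cones and negation
exchanges them, so each contains the linear combinations above, including the term `-M • μ(X)`; this
is `integral_mem_seqUp`. Passing to `-f` gives the two inclusions that end with an infimum.

Under the countable sup property the nets become sequences. Elementary functions are then
approximated from below by combinations of indicators of compact sets, which are approximated from
above in `C_c(X)`. The approximants of different elementary functions are unrelated, and merging
them requires suprema. These are taken among functions, not in `E`: `IsUpperApproximable.exists_sup`
shows that approximability survives, and `exists_seq_isUpperApproximable` extracts a diagonal
sequence.

For the equalities, preservation of the lattice structure lets a monotone sequence of integrals be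
lifted to a monotone sequence of functions, so the range of the integral on `L1 μ` is closed under
sequential limits (`seqUp_integral_subset`); it contains the range of `T`, and almost everywhere
boundedness identifies it with the integrals of bounded functions. -/

theorem isLUB_range_add {ι : Type*} [SemilatticeSup ι] {u v : ι → E} {a b : E} (hu : Monotone u)
    (hv : Monotone v) (ha : IsLUB (range u) a) (hb : IsLUB (range v) b) :
    IsLUB (range fun n => u n + v n) (a + b) := by
  refine ⟨?_, fun c hc => ?_⟩
  · rintro _ ⟨n, rfl⟩
    exact add_le_add (ha.1 ⟨n, rfl⟩) (hb.1 ⟨n, rfl⟩)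
  -- Directedness of the index set turns a bound on the diagonal into a bound on all mixed sums, so
  -- the two suprema can be taken one after the other.
  · have key : ∀ m n, u m + v n ≤ c := fun m n =>
      (add_le_add (hu le_sup_left) (hv le_sup_right)).trans (hc ⟨m ⊔ n, rfl⟩)
    have h1 : ∀ m, u m ≤ c - b := fun m => by
      rw [le_sub_comm]
      refine hb.2 ?_
      rintro _ ⟨n, rfl⟩
      rw [le_sub_iff_add_le']
      exact key m n
    rw [← le_sub_iff_add_le]
    refine ha.2 ?_
    rintro _ ⟨n, rfl⟩
    exact h1 n

theorem isLUB_range_neg {ι : Type*} {u : ι → E} {a : E} :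
    IsLUB (range fun i => -u i) (-a) ↔ IsGLB (range u) a := by
  rw [← isLUB_neg', ← Set.image_neg_eq_neg, ← Set.range_comp]
  rfl

theorem isGLB_range_neg {ι : Type*} {u : ι → E} {a : E} :
    IsGLB (range fun i => -u i) (-a) ↔ IsLUB (range u) a := by
  rw [← isGLB_neg', ← Set.image_neg_eq_neg, ← Set.range_comp]
  rfl

theorem isGLB_range_add {ι : Type*} [SemilatticeSup ι] {u v : ι → E} {a b : E} (hu : Antitone u)
    (hv : Antitone v) (ha : IsGLB (range u) a) (hb : IsGLB (range v) b) :
    IsGLB (range fun n => u n + v n) (a + b) := by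
  rw [← isLUB_range_neg] at ha hb ⊢
  have := isLUB_range_add hu.neg hv.neg ha hb
  simpa only [neg_add] using this

theorem isLUB_add_const {S : Set E} {a : E} (h : IsLUB S a) (c : E) :
    IsLUB ((fun x => x + c) '' S) (a + c) :=
  (OrderIso.addRight c).isLUB_image'.2 h

theorem isLUB_range_add_const {ι : Type*} {u : ι → E} {a : E} (h : IsLUB (range u) a) (c : E) :
    IsLUB (range fun i => u i + c) (a + c) := by
  have := isLUB_add_const h c
  rwa [← Set.range_comp] at this

variable [Module ℝ E] [IsOrderedModule ℝ E]

theorem isLUB_smul_image {S : Set E} {a : E} {c : ℝ} (hc : 0 ≤ c) (hS : S.Nonempty)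
    (h : IsLUB S a) : IsLUB ((fun x => c • x) '' S) (c • a) := by
  rcases hc.eq_or_lt with rfl | hc
  · simp [hS.image_const]
  · exact (OrderIso.smulRight hc).isLUB_image'.2 h

theorem isLUB_range_smul {ι : Type*} [Nonempty ι] {u : ι → E} {a : E} {c : ℝ} (hc : 0 ≤ c)
    (h : IsLUB (range u) a) : IsLUB (range fun i => c • u i) (c • a) := by
  have := isLUB_smul_image hc (range_nonempty u) h
  rwa [← Set.range_comp] at this

theorem isGLB_smul_image {S : Set E} {a : E} {c : ℝ} (hc : 0 ≤ c) (hS : S.Nonempty)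
    (h : IsGLB S a) : IsGLB ((fun x => c • x) '' S) (c • a) := by
  rcases hc.eq_or_lt with rfl | hc
  · simp [hS.image_const]
  · exact (OrderIso.smulRight hc).isGLB_image'.2 h

theorem isGLB_range_smul {ι : Type*} [Nonempty ι] {u : ι → E} {a : E} {c : ℝ} (hc : 0 ≤ c)
    (h : IsGLB (range u) a) : IsGLB (range fun i => c • u i) (c • a) := by
  have := isGLB_smul_image hc (range_nonempty u) h
  rwa [← Set.range_comp] at this

/-- A monotone complete partially ordered vector space is Archimedean. -/
theorem MonotoneComplete.nonpos_of_forall_nsmul_le (hE : MonotoneComplete E) {x y : E}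
    (h : ∀ n : ℕ, (n : ℝ) • x ≤ y) : x ≤ 0 := by
  have hy : 0 ≤ y := by simpa using h 0
  set u : ℕ → E := fun n => -((1 / ((n : ℝ) + 1)) • y) with hu
  have hmono : Monotone u := fun m n hmn => by
    have : (1 / ((n : ℝ) + 1)) ≤ 1 / ((m : ℝ) + 1) := Nat.one_div_le_one_div hmn
    exact neg_le_neg (smul_le_smul_of_nonneg_right this hy)
  have hneg : ∀ n, u n ≤ 0 := fun n => by
    simp only [hu, Left.neg_nonpos_iff]
    exact smul_nonneg (by positivity) hy
  obtain ⟨z, hz⟩ := hE (range u) (range_nonempty u)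
    (directedOn_range.2 hmono.directed_le) ⟨0, by rintro _ ⟨n, rfl⟩; exact hneg n⟩
  -- Each term is twice a later one, as `1/(n+1) = 2/(2n+2)`; hence the supremum `z` of the sequence
  -- `-y/(n+1)` satisfies `z ≤ 2z`.
  have h2 : z ≤ z + z := by
    refine hz.2 ?_
    rintro _ ⟨n, rfl⟩
    have : u n = u (2 * n + 1) + u (2 * n + 1) := by
      simp only [hu, ← neg_add, ← add_smul]
      congr 2
      push_cast; field_simp; ring
    rw [this]
    exact add_le_add (hz.1 ⟨_, rfl⟩) (hz.1 ⟨_, rfl⟩)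
  have hz0 : 0 ≤ z := by simpa using h2
  have hzx : z ≤ -x := by
    refine hz.2 ?_
    rintro _ ⟨n, rfl⟩
    have h3 := smul_le_smul_of_nonneg_left (h (n + 1))
      (by positivity : (0 : ℝ) ≤ 1 / ((n : ℝ) + 1))
    rw [smul_smul] at h3
    have h4 : (1 / ((n : ℝ) + 1)) * ((n + 1 : ℕ) : ℝ) = 1 := by push_cast; field_simp
    rw [h4, one_smul] at h3
    exact neg_le_neg h3
  exact neg_nonneg.1 (hz0.trans hzx)

theorem MonotoneComplete.le_of_forall_smul_le (hE : MonotoneComplete E) {x y : E}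
    (h : ∀ n : ℕ, (1 - 1 / ((n : ℝ) + 1)) • x ≤ y) : x ≤ y := by
  rw [← sub_nonpos]
  refine hE.nonpos_of_forall_nsmul_le (y := y) fun n => ?_
  have h1 := smul_le_smul_of_nonneg_left (h n) (by positivity : (0 : ℝ) ≤ n + 1)
  have h2 : ((n : ℝ) + 1) * (1 - 1 / ((n : ℝ) + 1)) = n := by field_simp; ring
  rw [smul_smul, h2, add_smul, one_smul] at h1
  rw [smul_sub, sub_le_iff_le_add']
  exact h1

end Order

/-! ### Finite additivity, continuity from below, and integrals of elementary functions. -/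

section Measure

variable {X E : Type*} [MeasurableSpace X] [AddCommGroup E] [PartialOrder E]
  (μ : FinitePosMeasure X E)

namespace FinitePosMeasure

variable [IsOrderedAddMonoid E]

theorem union {A B : Set X} (hA : MeasurableSet A) (hB : MeasurableSet B) (hAB : Disjoint A B) :
    μ.toFun (A ∪ B) = μ.toFun A + μ.toFun B := by
  set S : ℕ → Set X := fun n => if n = 0 then A else if n = 1 then B else ∅ with hS
  have hS0 : ∀ n, μ.toFun (S (n + 2)) = 0 := fun n => by simp [hS, μ.empty]
  have hSm : ∀ n, MeasurableSet (S n) := fun n => by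
    simp only [hS]; split_ifs <;> simp [hA, hB]
  have hd : Pairwise fun m n => Disjoint (S m) (S n) := fun m n hmn => by
    simp only [hS]
    split_ifs <;> first | omega | simp [hAB.symm]
  have hU : ⋃ n, S n = A ∪ B := by
    ext x
    simp only [mem_iUnion, mem_union]
    constructor
    · rintro ⟨n, hn⟩
      simp only [hS] at hn
      split_ifs at hn
      · exact Or.inl hn
      · exact Or.inr hn
      · exact hn.elim
    · rintro (h | h)
      · exact ⟨0, by simpa [hS] using h⟩
      · exact ⟨1, by simpa [hS] using h⟩
  have h2 : ∑ n ∈ Finset.range 2, μ.toFun (S n) = μ.toFun A + μ.toFun B := by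
    simp [Finset.sum_range_succ, hS]
  have hlub := μ.sigma_additive S hSm hd
  rw [hU] at hlub
  -- After padding with empty sets the partial sums are constant from the second on, so the supremum
  -- is a maximum.
  refine hlub.unique (IsGreatest.isLUB ⟨⟨2, h2⟩, ?_⟩)
  rintro _ ⟨N, rfl⟩
  rw [← h2]
  refine (Finset.sum_le_sum_of_subset_of_nonneg (t := Finset.range (2 + N))
    (Finset.range_mono (by omega)) fun i _ _ => μ.nonneg _ (hSm i)).trans ?_
  rw [Finset.sum_range_add]
  simp [add_comm 2, hS0]

theorem mono {A B : Set X} (hA : MeasurableSet A) (hB : MeasurableSet B) (h : A ⊆ B) :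
    μ.toFun A ≤ μ.toFun B := by
  rw [← union_sdiff_cancel h, μ.union hA (hB.diff hA) disjoint_sdiff_right]
  exact le_add_of_nonneg_right (μ.nonneg _ (hB.diff hA))

theorem biUnion_finset {ι : Type*} (s : Finset ι) (A : ι → Set X)
    (hA : ∀ i ∈ s, MeasurableSet (A i)) (hd : (s : Set ι).PairwiseDisjoint A) :
    μ.toFun (⋃ i ∈ s, A i) = ∑ i ∈ s, μ.toFun (A i) := by
  classical
  induction s using Finset.induction_on with
  | empty => simp [μ.empty]
  | insert a s ha ih =>
    rw [Finset.sum_insert ha, Finset.set_biUnion_insert, μ.union (hA a (by simp))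
      (s.measurableSet_biUnion fun i hi => hA i (by simp [hi])), ih fun i hi => hA i (by simp [hi])]
    · exact hd.subset (by simp)
    · rw [disjoint_iUnion₂_right]
      exact fun i hi => hd (by simp) (by simp [hi]) (by rintro rfl; exact ha hi)

theorem isLUB_iUnion {A : ℕ → Set X} (hA : ∀ n, MeasurableSet (A n)) (hm : Monotone A) :
    IsLUB (range fun n => μ.toFun (A n)) (μ.toFun (⋃ n, A n)) := by
  have hdm : ∀ n, MeasurableSet (disjointed A n) := fun n => MeasurableSet.disjointed hA n
  have h := μ.sigma_additive (disjointed A) hdm (disjoint_disjointed A)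
  have hsum : ∀ N, ∑ n ∈ Finset.range (N + 1), μ.toFun (disjointed A n) = μ.toFun (A N) :=
    fun N => by
      rw [← μ.biUnion_finset _ _ (fun i _ => hdm i) fun i _ j _ hij => disjoint_disjointed A hij,
        biUnion_range_succ_disjointed, hm.partialSups_eq]
  rw [iUnion_disjointed] at h
  refine ⟨?_, fun b hb => h.2 ?_⟩
  · rintro _ ⟨n, rfl⟩
    exact μ.mono (hA n) (MeasurableSet.iUnion hA) (subset_iUnion A n)
  · rintro _ ⟨N, rfl⟩
    -- The measure of `A N` is the sum of `N + 1` disjoint pieces; one extra non-negative term also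
    -- covers the empty sum at `N = 0`.
    refine (Finset.sum_le_sum_of_subset_of_nonneg (t := Finset.range (N + 1))
      (Finset.range_mono (by omega)) fun i _ _ => μ.nonneg _ (hdm i)).trans ?_
    rw [hsum]
    exact hb ⟨N, rfl⟩

end FinitePosMeasure

variable [IsOrderedAddMonoid E] [Module ℝ E]

theorem elementaryIntegral_map {β : Type*} (g : β → ℝ≥0) (f : SimpleFunc X β) :
    elementaryIntegral μ (f.map g) = ∑ x ∈ f.range, (g x : ℝ) • μ.toFun (f ⁻¹' {x}) := by
  classical
  simp only [elementaryIntegral, SimpleFunc.range_map]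
  refine Finset.sum_image' _ fun b hb => ?_
  rcases SimpleFunc.mem_range.1 hb with ⟨a, rfl⟩
  have h : ∀ t : Finset β, f ⁻¹' (t : Set β) = ⋃ y ∈ t, f ⁻¹' {y} := fun t => by
    ext x; simp
  rw [SimpleFunc.map_preimage_singleton, h, μ.biUnion_finset _ _
    (fun i _ => f.measurableSet_preimage _), Finset.smul_sum]
  · refine Finset.sum_congr ?_ ?_
    · congr
    · grind
  · intro i _ j _ hij
    exact Disjoint.preimage _ (by simpa using hij)

theorem elementaryIntegral_add (f g : SimpleFunc X ℝ≥0) :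
    elementaryIntegral μ (f + g) = elementaryIntegral μ f + elementaryIntegral μ g :=
  calc
    elementaryIntegral μ (f + g) = ∑ x ∈ (f.pair g).range,
        ((x.1 : ℝ) • μ.toFun (f.pair g ⁻¹' {x}) + (x.2 : ℝ) • μ.toFun (f.pair g ⁻¹' {x})) := by
      rw [SimpleFunc.add_eq_map₂, elementaryIntegral_map]
      exact Finset.sum_congr rfl fun a _ => by rw [← add_smul]; rfl
    _ = elementaryIntegral μ ((f.pair g).map Prod.fst) +
          elementaryIntegral μ ((f.pair g).map Prod.snd) := by
      rw [Finset.sum_add_distrib, elementaryIntegral_map, elementaryIntegral_map]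
    _ = _ := rfl

theorem elementaryIntegral_smul (c : ℝ≥0) (f : SimpleFunc X ℝ≥0) :
    elementaryIntegral μ (f.map fun x => c * x) = (c : ℝ) • elementaryIntegral μ f := by
  rw [elementaryIntegral_map, elementaryIntegral, Finset.smul_sum]
  exact Finset.sum_congr rfl fun a _ => by rw [smul_smul]; rfl

theorem elementaryIntegral_zero : elementaryIntegral μ 0 = 0 := by
  have h := elementaryIntegral_smul μ 0 0
  rw [NNReal.coe_zero, zero_smul] at h
  rw [← h]
  congr 1
  ext x; simp

theorem elementaryIntegral_indicator (c : ℝ≥0) {s : Set X} (hs : MeasurableSet s) :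
    elementaryIntegral μ
      (SimpleFunc.piecewise s hs (SimpleFunc.const X c) (SimpleFunc.const X 0)) =
      (c : ℝ) • μ.toFun s := by
  classical
  set f : SimpleFunc X (Prop) := SimpleFunc.piecewise s hs (SimpleFunc.const X True)
    (SimpleFunc.const X False) with hf
  have h1 : SimpleFunc.piecewise s hs (SimpleFunc.const X c) (SimpleFunc.const X 0) =
      f.map fun p => if p then c else 0 := by
    ext x
    by_cases hx : x ∈ s <;> simp [hf, hx]
  have h2 : f ⁻¹' {True} = s := by
    ext x
    by_cases hx : x ∈ s <;> simp [hf, hx]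
  rw [h1, elementaryIntegral_map, Finset.sum_eq_single True, h2]
  · simp
  · intro p _ hp
    simp [show ¬ p by simpa using hp]
  · intro hT
    rw [(SimpleFunc.preimage_eq_empty_iff f True).2 hT, μ.empty, smul_zero]

variable [IsOrderedModule ℝ E]

theorem elementaryIntegral_nonneg (f : SimpleFunc X ℝ≥0) : 0 ≤ elementaryIntegral μ f :=
  Finset.sum_nonneg fun r _ => smul_nonneg r.2 (μ.nonneg _ (f.measurableSet_preimage _))

theorem elementaryIntegral_mono {f g : SimpleFunc X ℝ≥0} (h : ∀ x, f x ≤ g x) :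
    elementaryIntegral μ f ≤ elementaryIntegral μ g := by
  have : g = f + (g - f) := by
    ext x; simp [h x]
  rw [this, elementaryIntegral_add]
  exact le_add_of_nonneg_right (elementaryIntegral_nonneg μ _)

theorem isLUB_elementaryIntegral_restrict {A : ℕ → Set X} (hA : ∀ n, MeasurableSet (A n))
    (hm : Monotone A) (hU : ⋃ n, A n = univ) (f : SimpleFunc X ℝ≥0) :
    IsLUB (range fun n => elementaryIntegral μ (f.restrict (A n))) (elementaryIntegral μ f) := by
  induction f using SimpleFunc.induction with
  | @const c s hs =>
    have : ∀ n, (SimpleFunc.piecewise s hs (SimpleFunc.const X c) (SimpleFunc.const X 0)).restrict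
        (A n) = SimpleFunc.piecewise (s ∩ A n) (hs.inter (hA n)) (SimpleFunc.const X c)
          (SimpleFunc.const X 0) := fun n => by
      ext x
      by_cases hx : x ∈ s <;> by_cases hx' : x ∈ A n <;>
        simp [SimpleFunc.restrict_apply, hA n, hx, hx']
    simp_rw [this, elementaryIntegral_indicator]
    refine isLUB_range_smul c.2 ?_
    have h := μ.isLUB_iUnion (fun n => hs.inter (hA n))
      fun m n hmn => inter_subset_inter_right s (hm hmn)
    rwa [← inter_iUnion, hU, inter_univ] at h
  | @add f g hfg hf hg =>
    have : ∀ n, (f + g).restrict (A n) = f.restrict (A n) + g.restrict (A n) := fun n => by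
      ext x; simp [SimpleFunc.restrict_apply, hA n, indicator_add]
    simp_rw [this, elementaryIntegral_add]
    refine isLUB_range_add ?_ ?_ hf hg <;>
    · intro m n hmn
      refine elementaryIntegral_mono μ fun x => ?_
      simp only [SimpleFunc.restrict_apply, hA]
      exact indicator_le_indicator_of_subset (hm hmn) (fun _ => zero_le) x

end Measure

/-! ### The order integral, monotone convergence, and signed integrals. -/

section Integral

variable {X E : Type*} [MeasurableSpace X] [AddCommGroup E] [PartialOrder E]
  [IsOrderedAddMonoid E] [Module ℝ E] [IsOrderedModule ℝ E] {μ : FinitePosMeasure X E}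

/-- `a` is the supremum of the integrals of all elementary functions below `f`. -/
def HasIntegral (μ : FinitePosMeasure X E) (f : X → ℝ≥0∞) (a : E) : Prop :=
  IsLUB (elementaryIntegral μ '' {φ | ∀ x, (φ x : ℝ≥0∞) ≤ f x}) a

/-- The core of monotone convergence. For `c < 1` the sets where `c ψ ≤ f n` exhaust `X`, so `c •
∫ψ` is the supremum of integrals of elementary functions each lying below some `f n`; the
Archimedean property then lets `c` tend to 1. -/
theorem elementaryIntegral_le_of_le_iSup (hE : MonotoneComplete E) {f : ℕ → X → ℝ≥0∞}
    (hf : ∀ n, Measurable (f n)) (hm : Monotone f) {b : E}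
    (hb : ∀ n, ∀ φ : SimpleFunc X ℝ≥0, (∀ x, (φ x : ℝ≥0∞) ≤ f n x) → elementaryIntegral μ φ ≤ b)
    {ψ : SimpleFunc X ℝ≥0} (hψ : ∀ x, (ψ x : ℝ≥0∞) ≤ ⨆ n, f n x) :
    elementaryIntegral μ ψ ≤ b := by
  refine hE.le_of_forall_smul_le fun k => ?_
  have hc0 : (0 : ℝ) ≤ 1 - 1 / ((k : ℝ) + 1) := by
    rw [sub_nonneg, div_le_one (by positivity)]; linarith [(Nat.cast_nonneg k : (0 : ℝ) ≤ k)]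
  have hc1 : 1 - 1 / ((k : ℝ) + 1) < 1 := by
    rw [sub_lt_self_iff]; positivity
  lift 1 - 1 / ((k : ℝ) + 1) to ℝ≥0 using hc0 with c
  set A : ℕ → Set X := fun n => {x | ((c * ψ x : ℝ≥0) : ℝ≥0∞) ≤ f n x} with hA
  have hAm : ∀ n, MeasurableSet (A n) := fun n =>
    measurableSet_le (measurable_const.mul ψ.measurable).coe_nnreal_ennreal (hf n)
  have hAmono : Monotone A := fun m n hmn x hx => le_trans hx (hm hmn x)
  have hU : ⋃ n, A n = univ := by
    refine eq_univ_of_forall fun x => ?_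
    rw [mem_iUnion]
    by_cases h0 : ψ x = 0
    · exact ⟨0, by simp [hA, h0]⟩
    · have h1 : ((c * ψ x : ℝ≥0) : ℝ≥0∞) < ⨆ n, f n x := by
        refine lt_of_lt_of_le ?_ (hψ x)
        rw [ENNReal.coe_lt_coe]
        exact mul_lt_of_lt_one_left (pos_iff_ne_zero.2 h0) (by exact_mod_cast hc1)
      obtain ⟨n, hn⟩ := lt_iSup_iff.1 h1
      exact ⟨n, hn.le⟩
  refine (isLUB_range_smul c.2 (isLUB_elementaryIntegral_restrict μ hAm hAmono hU ψ)).2 ?_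
  rintro _ ⟨n, rfl⟩
  change (c : ℝ) • elementaryIntegral μ (ψ.restrict (A n)) ≤ b
  rw [← elementaryIntegral_smul]
  refine hb n _ fun x => ?_
  by_cases hx : x ∈ A n
  · rw [SimpleFunc.map_apply, SimpleFunc.restrict_apply _ (hAm n), indicator_of_mem hx]
    exact hx
  · simp [hAm n, hx]

theorem HasIntegral.unique {f : X → ℝ≥0∞} {a b : E} (ha : HasIntegral μ f a)
    (hb : HasIntegral μ f b) : a = b :=
  IsLUB.unique ha hb

theorem HasIntegral.nonneg {f : X → ℝ≥0∞} {a : E} (ha : HasIntegral μ f a) : 0 ≤ a := by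
  rw [← elementaryIntegral_zero μ]
  exact ha.1 ⟨0, fun x => by simp, rfl⟩

theorem hasIntegral_simpleFunc (φ : SimpleFunc X ℝ≥0) :
    HasIntegral μ (fun x => (φ x : ℝ≥0∞)) (elementaryIntegral μ φ) := by
  refine IsGreatest.isLUB ⟨⟨φ, fun x => le_rfl, rfl⟩, ?_⟩
  rintro _ ⟨ψ, hψ, rfl⟩
  exact elementaryIntegral_mono μ fun x => ENNReal.coe_le_coe.1 (hψ x)

/-- The two families have the same upper bounds. This makes the integral independent of the
approximating sequence. -/
theorem hasIntegral_iff_of_monotone (hE : MonotoneComplete E) {φ : ℕ → SimpleFunc X ℝ≥0}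
    (hφ : Monotone φ) {f : X → ℝ≥0∞} (hf : ∀ x, ⨆ n, (φ n x : ℝ≥0∞) = f x) {a : E} :
    HasIntegral μ f a ↔ IsLUB (range fun n => elementaryIntegral μ (φ n)) a := by
  unfold HasIntegral IsLUB
  have : upperBounds (elementaryIntegral μ '' {φ | ∀ x, (φ x : ℝ≥0∞) ≤ f x}) =
      upperBounds (range fun n => elementaryIntegral μ (φ n)) := by
    ext b
    constructor
    · rintro hb _ ⟨n, rfl⟩
      exact hb ⟨φ n, fun x => (le_iSup (fun n => (φ n x : ℝ≥0∞)) n).trans (hf x).le, rfl⟩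
    · rintro hb _ ⟨ψ, hψ, rfl⟩
      refine elementaryIntegral_le_of_le_iSup (μ := μ) hE (f := fun n x => (φ n x : ℝ≥0∞))
        (fun n => (φ n).measurable.coe_nnreal_ennreal)
        (fun m n hmn x => ENNReal.coe_le_coe.2 (hφ hmn x)) (fun n χ hχ => ?_)
        (fun x => (hψ x).trans (hf x).ge)
      exact (elementaryIntegral_mono μ fun x => ENNReal.coe_le_coe.1 (hχ x)).trans (hb ⟨n, rfl⟩)
  rw [this]

theorem exists_simpleFunc_monotone {f : X → ℝ≥0∞} (hf : Measurable f) :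
    ∃ φ : ℕ → SimpleFunc X ℝ≥0, Monotone φ ∧ ∀ x, ⨆ n, (φ n x : ℝ≥0∞) = f x := by
  have hlt : ∀ n x, SimpleFunc.eapprox f n x ≠ ∞ := fun n x => (SimpleFunc.eapprox_lt_top f n x).ne
  refine ⟨fun n => (SimpleFunc.eapprox f n).map ENNReal.toNNReal, fun m n hmn x => ?_,
    fun x => ?_⟩
  · exact ENNReal.toNNReal_mono (hlt n x) (SimpleFunc.monotone_eapprox f hmn x)
  · simp [ENNReal.coe_toNNReal (hlt _ x), SimpleFunc.iSup_eapprox_apply hf]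

theorem monotone_elementaryIntegral {φ : ℕ → SimpleFunc X ℝ≥0} (hφ : Monotone φ) :
    Monotone fun n => elementaryIntegral μ (φ n) :=
  fun _ _ hmn => elementaryIntegral_mono μ (hφ hmn)

theorem HasIntegral.add (hE : MonotoneComplete E) {f g : X → ℝ≥0∞} {a b : E} (hf : Measurable f)
    (hg : Measurable g) (ha : HasIntegral μ f a) (hb : HasIntegral μ g b) :
    HasIntegral μ (fun x => f x + g x) (a + b) := by
  obtain ⟨φ, hφ, hφf⟩ := exists_simpleFunc_monotone hf
  obtain ⟨ψ, hψ, hψg⟩ := exists_simpleFunc_monotone hg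
  rw [hasIntegral_iff_of_monotone hE hφ hφf] at ha
  rw [hasIntegral_iff_of_monotone hE hψ hψg] at hb
  rw [hasIntegral_iff_of_monotone hE (hφ.add hψ)]
  · simp only [elementaryIntegral_add]
    exact isLUB_range_add (monotone_elementaryIntegral hφ) (monotone_elementaryIntegral hψ) ha hb
  · intro x
    rw [← hφf, ← hψg, ENNReal.iSup_add_iSup_of_monotone]
    · simp
    · exact fun m n hmn => ENNReal.coe_le_coe.2 (hφ hmn x)
    · exact fun m n hmn => ENNReal.coe_le_coe.2 (hψ hmn x)

theorem HasIntegral.exists_of_le (hE : MonotoneComplete E) {f g : X → ℝ≥0∞} {b : E}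
    (hf : Measurable f) (hb : HasIntegral μ g b) (h : ∀ x, f x ≤ g x) :
    ∃ a, HasIntegral μ f a := by
  obtain ⟨φ, hφ, hφf⟩ := exists_simpleFunc_monotone hf
  simp_rw [hasIntegral_iff_of_monotone (μ := μ) hE hφ hφf]
  refine hE _ (range_nonempty _)
    (directedOn_range.2 (monotone_elementaryIntegral hφ).directed_le) ⟨b, ?_⟩
  rintro _ ⟨n, rfl⟩
  refine hb.1 ⟨φ n, fun x => ?_, rfl⟩
  exact ((le_iSup (fun n => (φ n x : ℝ≥0∞)) n).trans (hφf x).le).trans (h x)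

/-- Monotone convergence. -/
theorem HasIntegral.iSup (hE : MonotoneComplete E) {f : ℕ → X → ℝ≥0∞} {a : ℕ → E} {b : E}
    (hf : ∀ n, Measurable (f n)) (hm : Monotone f) (ha : ∀ n, HasIntegral μ (f n) (a n))
    (hb : IsLUB (range a) b) : HasIntegral μ (fun x => ⨆ n, f n x) b := by
  refine ⟨?_, fun c hc => hb.2 ?_⟩
  · rintro _ ⟨ψ, hψ, rfl⟩
    exact elementaryIntegral_le_of_le_iSup hE hf hm
      (fun n φ hφ => ((ha n).1 ⟨φ, hφ, rfl⟩).trans (hb.1 ⟨n, rfl⟩)) hψ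
  · rintro _ ⟨n, rfl⟩
    refine (ha n).2 ?_
    rintro _ ⟨φ, hφ, rfl⟩
    exact hc ⟨φ, fun x => (hφ x).trans (le_iSup (fun n => f n x) n), rfl⟩

theorem elementaryIntegral_restrict_null {N : Set X} (hN : MeasurableSet N) (h0 : μ.toFun N = 0)
    (φ : SimpleFunc X ℝ≥0) : elementaryIntegral μ (φ.restrict N) = 0 := by
  refine le_antisymm ?_ (elementaryIntegral_nonneg μ _)
  refine (elementaryIntegral_mono μ (g := SimpleFunc.piecewise N hN
    (SimpleFunc.const X (φ.range.sup id)) (SimpleFunc.const X 0)) fun x => ?_).trans ?_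
  · by_cases hx : x ∈ N
    · simpa [SimpleFunc.restrict_apply, hN, hx] using
        Finset.le_sup (f := id) (φ.mem_range_self x)
    · simp [SimpleFunc.restrict_apply, hN, hx]
  · rw [elementaryIntegral_indicator, h0, smul_zero]

theorem elementaryIntegral_restrict_compl {N : Set X} (hN : MeasurableSet N) (h0 : μ.toFun N = 0)
    (φ : SimpleFunc X ℝ≥0) : elementaryIntegral μ (φ.restrict Nᶜ) = elementaryIntegral μ φ := by
  have : φ = φ.restrict Nᶜ + φ.restrict N := by
    ext x
    by_cases hx : x ∈ N <;> simp [hN, hN.compl, hx]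
  conv_rhs => rw [this, elementaryIntegral_add, elementaryIntegral_restrict_null hN h0, add_zero]

/-- Cutting an elementary function off on the null set leaves its integral unchanged, so both
functions have the same set of lower elementary integrals. -/
theorem HasIntegral.congr_null {f g : X → ℝ≥0∞} {a : E} {N : Set X} (hN : MeasurableSet N)
    (h0 : μ.toFun N = 0) (hfg : ∀ x, x ∉ N → f x = g x) (ha : HasIntegral μ f a) :
    HasIntegral μ g a := by
  have key : ∀ f g : X → ℝ≥0∞, (∀ x, x ∉ N → f x = g x) →
      elementaryIntegral μ '' {φ | ∀ x, (φ x : ℝ≥0∞) ≤ f x} ⊆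
        elementaryIntegral μ '' {φ | ∀ x, (φ x : ℝ≥0∞) ≤ g x} := by
    rintro f g hfg _ ⟨φ, hφ, rfl⟩
    refine ⟨φ.restrict Nᶜ, fun x => ?_, elementaryIntegral_restrict_compl hN h0 φ⟩
    by_cases hx : x ∈ N
    · simp [hN.compl, hx]
    · simpa [SimpleFunc.restrict_apply, hN.compl, hx, ← hfg x hx] using hφ x
  unfold HasIntegral
  rwa [(key g f fun x hx => (hfg x hx).symm).antisymm (key f g hfg)]

/-- Every multiple `n • μ{f = ∞}` is an elementary integral below `f`, hence at most `a`; the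
Archimedean property applies. -/
theorem HasIntegral.measure_eq_top (hE : MonotoneComplete E) {f : X → ℝ≥0∞} {a : E}
    (hf : Measurable f) (ha : HasIntegral μ f a) : μ.toFun {x | f x = ∞} = 0 := by
  have hN : MeasurableSet {x | f x = ∞} := hf (measurableSet_singleton ∞)
  refine le_antisymm (hE.nonpos_of_forall_nsmul_le (y := a) fun n => ?_) (μ.nonneg _ hN)
  have h := elementaryIntegral_indicator μ n hN
  rw [NNReal.coe_natCast] at h
  rw [← h]
  refine ha.1 ⟨_, fun x => ?_, rfl⟩
  by_cases hx : f x = ∞ <;> simp [SimpleFunc.coe_piecewise, Set.piecewise, hx]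

theorem HasIntegral.orderIntegral_eq (hE : MonotoneComplete E) {f : X → ℝ≥0∞} {a : E}
    (hf : Measurable f) (ha : HasIntegral μ f a) : orderIntegral μ f = a := by
  obtain ⟨φ, hφ, hφf⟩ := exists_simpleFunc_monotone hf
  have hex : ∃ a, HasOrderIntegral μ f a := by
    refine ⟨a, φ, hφ, hφf, ?_⟩
    rw [hasIntegral_iff_of_monotone hE hφ hφf] at ha
    refine ⟨?_, fun b hb => ?_⟩
    · rintro _ ⟨n, rfl⟩
      exact WithTop.coe_le_coe.2 (ha.1 ⟨n, rfl⟩)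
    · induction b using WithTop.recTopCoe with
      | top => exact le_top
      | coe b =>
        refine WithTop.coe_le_coe.2 (ha.2 ?_)
        rintro _ ⟨n, rfl⟩
        exact WithTop.coe_le_coe.1 (hb ⟨n, rfl⟩)
  rw [orderIntegral, dif_pos hex]
  obtain ⟨ψ, hψ, hψf, hlub⟩ := hex.choose_spec
  have ha' := (hasIntegral_iff_of_monotone hE hψ hψf).1 ha
  -- The chosen supremum lives in `WithTop E`; being below the finite `a` rules out `⊤`.
  have hle : hex.choose ≤ a := hlub.2 (by
    rintro _ ⟨n, rfl⟩
    exact WithTop.coe_le_coe.2 (ha'.1 ⟨n, rfl⟩))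
  generalize hex.choose = c at hlub hle
  induction c using WithTop.recTopCoe with
  | top => simp at hle
  | coe c =>
    refine le_antisymm hle (WithTop.coe_le_coe.2 (ha'.2 ?_))
    rintro _ ⟨n, rfl⟩
    exact WithTop.coe_le_coe.1 (hlub.1 ⟨n, rfl⟩)

theorem exists_hasIntegral_of_orderIntegral_ne_top (hE : MonotoneComplete E) {f : X → ℝ≥0∞}
    (h : orderIntegral μ f ≠ ⊤) : ∃ a, HasIntegral μ f a := by
  by_cases hex : ∃ a, HasOrderIntegral μ f a
  · rw [orderIntegral, dif_pos hex] at h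
    obtain ⟨ψ, hψ, hψf, hlub⟩ := hex.choose_spec
    generalize hex.choose = c at hlub h
    induction c using WithTop.recTopCoe with
    | top => simp at h
    | coe c =>
      refine ⟨c, (hasIntegral_iff_of_monotone hE hψ hψf).2 ⟨?_, fun b hb => ?_⟩⟩
      · rintro _ ⟨n, rfl⟩
        exact WithTop.coe_le_coe.1 (hlub.1 ⟨n, rfl⟩)
      · refine WithTop.coe_le_coe.1 (hlub.2 ?_)
        rintro _ ⟨n, rfl⟩
        exact WithTop.coe_le_coe.2 (hb ⟨n, rfl⟩)
  · rw [orderIntegral, dif_neg hex] at h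
    exact (h rfl).elim

/-- `f` is integrable with integral `e`, through some decomposition of `f` as a difference of
non-negative integrable functions. -/
def HasSignedIntegral (μ : FinitePosMeasure X E) (f : X → ℝ) (e : E) : Prop :=
  ∃ (u v : X → ℝ≥0) (a b : E), Measurable u ∧ Measurable v ∧
    HasIntegral μ (fun x => (u x : ℝ≥0∞)) a ∧ HasIntegral μ (fun x => (v x : ℝ≥0∞)) b ∧
      (∀ x, f x = u x - v x) ∧ e = a - b

theorem HasSignedIntegral.measurable {f : X → ℝ} {e : E} (h : HasSignedIntegral μ f e) :
    Measurable f := by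
  obtain ⟨u, v, a, b, hu, hv, -, -, hf, -⟩ := h
  rw [show f = fun x => (u x : ℝ) - v x from funext hf]
  exact hu.coe_nnreal_real.sub hv.coe_nnreal_real

theorem HasSignedIntegral.of_le (hE : MonotoneComplete E) {f : X → ℝ} {g : X → ℝ≥0∞} {b : E}
    (hf : Measurable f) (hb : HasIntegral μ g b) (h : ∀ x, ENNReal.ofReal |f x| ≤ g x) :
    ∃ e, HasSignedIntegral μ f e := by
  obtain ⟨a, ha⟩ := HasIntegral.exists_of_le hE (f := fun x => ENNReal.ofReal (f x))
    hf.ennreal_ofReal hb fun x => (ENNReal.ofReal_le_ofReal (le_abs_self _)).trans (h x)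
  obtain ⟨c, hc⟩ := HasIntegral.exists_of_le hE (f := fun x => ENNReal.ofReal (-f x))
    hf.neg.ennreal_ofReal hb fun x => (ENNReal.ofReal_le_ofReal (neg_le_abs _)).trans (h x)
  refine ⟨a - c, fun x => (f x).toNNReal, fun x => (-f x).toNNReal, a, c, hf.real_toNNReal,
    hf.neg.real_toNNReal, ha, hc, fun x => ?_, rfl⟩
  simp only [Real.coe_toNNReal']
  rw [max_zero_sub_max_neg_zero_eq_self]

/-- If `f = u - v`, then `f⁺ + v = u + f⁻`, and additivity with uniqueness of the non-negative
integral gives the same difference for either decomposition. -/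
theorem HasSignedIntegral.mem_L1_and_integral_eq (hE : MonotoneComplete E) {f : X → ℝ} {e : E}
    (h : HasSignedIntegral μ f e) : f ∈ L1 μ ∧ integral μ f = e := by
  have hf := h.measurable
  obtain ⟨u, v, a, b, hu, hv, ha, hb, huv, rfl⟩ := h
  have hu' := hu.coe_nnreal_ennreal
  have hv' := hv.coe_nnreal_ennreal
  have hab := ha.add hE hu' hv' hb
  have hle : ∀ x, |f x| ≤ u x + v x := fun x => by
    rw [huv, abs_le]; constructor <;> linarith [(u x).2, (v x).2]
  have hle' : ∀ x, ENNReal.ofReal |f x| ≤ (u x : ℝ≥0∞) + v x := fun x => by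
    refine ENNReal.ofReal_le_of_le_toReal ?_
    simpa [ENNReal.toReal_add] using hle x
  obtain ⟨s, hs⟩ := HasIntegral.exists_of_le hE (measurable_norm.comp hf).ennreal_ofReal hab hle'
  obtain ⟨p, hp⟩ := HasIntegral.exists_of_le hE (f := fun x => ENNReal.ofReal (f x))
    hf.ennreal_ofReal hab fun x => (ENNReal.ofReal_le_ofReal (le_abs_self _)).trans (hle' x)
  obtain ⟨q, hq⟩ := HasIntegral.exists_of_le hE (f := fun x => ENNReal.ofReal (-f x))
    hf.neg.ennreal_ofReal hab fun x => (ENNReal.ofReal_le_ofReal (neg_le_abs _)).trans (hle' x)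
  refine ⟨⟨hf, ?_⟩, ?_⟩
  · have := hs.orderIntegral_eq hE (measurable_norm.comp hf).ennreal_ofReal
    simp only [Function.comp_apply, Real.norm_eq_abs] at this
    rw [this]
    exact WithTop.coe_ne_top
  · rw [integral, hp.orderIntegral_eq hE hf.ennreal_ofReal,
      hq.orderIntegral_eq hE (f := fun x => ENNReal.ofReal (-f x)) hf.neg.ennreal_ofReal,
      WithTop.untopD_coe, WithTop.untopD_coe,
      sub_eq_sub_iff_add_eq_add]
    have h1 := hp.add hE hf.ennreal_ofReal hv' hb
    have h2 := ha.add hE hu' hf.neg.ennreal_ofReal hq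
    refine h1.unique ?_
    convert h2 using 2 with x
    rw [ENNReal.ofReal, ENNReal.ofReal, ← ENNReal.coe_add, ← ENNReal.coe_add, ENNReal.coe_inj,
      ← NNReal.coe_inj]
    push_cast
    rw [Real.coe_toNNReal', Real.coe_toNNReal']
    have hx := max_zero_sub_max_neg_zero_eq_self (f x)
    rw [Pi.neg_apply]
    linarith [huv x]

theorem hasSignedIntegral_of_mem_L1 (hE : MonotoneComplete E) {f : X → ℝ} (h : f ∈ L1 μ) :
    HasSignedIntegral μ f (integral μ f) := by
  obtain ⟨b, hb⟩ := exists_hasIntegral_of_orderIntegral_ne_top hE h.2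
  obtain ⟨e, he⟩ := HasSignedIntegral.of_le hE h.1 hb fun x => le_rfl
  rwa [(he.mem_L1_and_integral_eq hE).2]

theorem HasSignedIntegral.unique (hE : MonotoneComplete E) {f : X → ℝ} {e e' : E}
    (h : HasSignedIntegral μ f e) (h' : HasSignedIntegral μ f e') : e = e' :=
  (h.mem_L1_and_integral_eq hE).2.symm.trans (h'.mem_L1_and_integral_eq hE).2

theorem HasIntegral.hasSignedIntegral {f : X → ℝ} {e : E} (hf : Measurable f) (h0 : ∀ x, 0 ≤ f x)
    (h : HasIntegral μ (fun x => ENNReal.ofReal (f x)) e) : HasSignedIntegral μ f e := by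
  refine ⟨fun x => (f x).toNNReal, 0, e, 0, hf.real_toNNReal, measurable_const, h, ?_,
    fun x => by simp [h0 x], by simp⟩
  simpa [elementaryIntegral_zero] using hasIntegral_simpleFunc (μ := μ) 0

theorem HasSignedIntegral.hasIntegral (hE : MonotoneComplete E) {f : X → ℝ} {e : E}
    (h0 : ∀ x, 0 ≤ f x) (h : HasSignedIntegral μ f e) :
    HasIntegral μ (fun x => ENNReal.ofReal (f x)) e := by
  obtain ⟨b, hb⟩ := exists_hasIntegral_of_orderIntegral_ne_top hE (h.mem_L1_and_integral_eq hE).1.2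
  simp only [abs_of_nonneg (h0 _)] at hb
  rwa [h.unique hE (hb.hasSignedIntegral h.measurable h0)]

theorem HasSignedIntegral.neg {f : X → ℝ} {e : E} (h : HasSignedIntegral μ f e) :
    HasSignedIntegral μ (fun x => -f x) (-e) := by
  obtain ⟨u, v, a, b, hu, hv, ha, hb, huv, rfl⟩ := h
  exact ⟨v, u, b, a, hv, hu, hb, ha, fun x => by simp only [huv]; ring, by abel⟩

theorem HasSignedIntegral.add (hE : MonotoneComplete E) {f g : X → ℝ} {e e' : E}
    (h : HasSignedIntegral μ f e) (h' : HasSignedIntegral μ g e') :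
    HasSignedIntegral μ (fun x => f x + g x) (e + e') := by
  obtain ⟨u, v, a, b, hu, hv, ha, hb, huv, rfl⟩ := h
  obtain ⟨u', v', a', b', hu', hv', ha', hb', huv', rfl⟩ := h'
  refine ⟨u + u', v + v', a + a', b + b', hu.add hu', hv.add hv', ?_, ?_,
    fun x => by simp only [huv, huv', Pi.add_apply, NNReal.coe_add]; ring, by abel⟩
  · simpa using ha.add hE hu.coe_nnreal_ennreal hu'.coe_nnreal_ennreal ha'
  · simpa using hb.add hE hv.coe_nnreal_ennreal hv'.coe_nnreal_ennreal hb'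

theorem HasSignedIntegral.sub (hE : MonotoneComplete E) {f g : X → ℝ} {e e' : E}
    (h : HasSignedIntegral μ f e) (h' : HasSignedIntegral μ g e') :
    HasSignedIntegral μ (fun x => f x - g x) (e - e') := by
  simpa only [sub_eq_add_neg] using h.add hE h'.neg

theorem HasSignedIntegral.nonneg (hE : MonotoneComplete E) {f : X → ℝ} {e : E}
    (h : HasSignedIntegral μ f e) (h0 : ∀ x, 0 ≤ f x) : 0 ≤ e :=
  (h.hasIntegral hE h0).nonneg

theorem HasSignedIntegral.mono (hE : MonotoneComplete E) {f g : X → ℝ} {e e' : E}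
    (h : HasSignedIntegral μ f e) (h' : HasSignedIntegral μ g e') (hfg : ∀ x, f x ≤ g x) :
    e ≤ e' :=
  sub_nonneg.1 ((h'.sub hE h).nonneg hE fun x => sub_nonneg.2 (hfg x))

theorem HasSignedIntegral.exists_sup (hE : MonotoneComplete E) {f g : X → ℝ} {e e' : E}
    (h : HasSignedIntegral μ f e) (h' : HasSignedIntegral μ g e') :
    ∃ d, HasSignedIntegral μ (f ⊔ g) d := by
  obtain ⟨a, ha⟩ := exists_hasIntegral_of_orderIntegral_ne_top hE (h.mem_L1_and_integral_eq hE).1.2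
  obtain ⟨b, hb⟩ := exists_hasIntegral_of_orderIntegral_ne_top hE
    (h'.mem_L1_and_integral_eq hE).1.2
  refine HasSignedIntegral.of_le hE (h.measurable.sup h'.measurable)
    (ha.add hE (measurable_norm.comp h.measurable).ennreal_ofReal
      (measurable_norm.comp h'.measurable).ennreal_ofReal hb) fun x => ?_
  simp only [Function.comp_apply, Real.norm_eq_abs]
  rw [← ENNReal.ofReal_add (abs_nonneg _) (abs_nonneg _)]
  refine ENNReal.ofReal_le_ofReal ((abs_max_le_max_abs_abs).trans ?_)
  exact max_le_add_of_nonneg (abs_nonneg _) (abs_nonneg _)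

theorem HasSignedIntegral.congr_null (hE : MonotoneComplete E) {f g : X → ℝ} {e : E} {N : Set X}
    (hN : MeasurableSet N) (h0 : μ.toFun N = 0) (hfg : ∀ x, x ∉ N → f x = g x)
    (hg : Measurable g) (h : HasSignedIntegral μ f e) : HasSignedIntegral μ g e := by
  have hd : HasSignedIntegral μ (fun x => g x - f x) 0 := by
    refine ⟨fun x => (g x - f x).toNNReal, fun x => (-(g x - f x)).toNNReal, 0, 0,
      (hg.sub h.measurable).real_toNNReal, (hg.sub h.measurable).neg.real_toNNReal, ?_, ?_,
      fun x => ?_, by simp⟩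
    · have := hasIntegral_simpleFunc (μ := μ) 0
      rw [elementaryIntegral_zero] at this
      exact this.congr_null hN h0 fun x hx => by simp [hfg x hx]
    · have := hasIntegral_simpleFunc (μ := μ) 0
      rw [elementaryIntegral_zero] at this
      exact this.congr_null hN h0 fun x hx => by simp [hfg x hx]
    · simp only [Real.coe_toNNReal']
      rw [max_zero_sub_max_neg_zero_eq_self]
  simpa using hd.add hE h

/-- Monotone convergence for increasing sequences with bounded integrals. -/
theorem HasSignedIntegral.exists_of_monotone (hE : MonotoneComplete E) {f : ℕ → X → ℝ} {e : ℕ → E}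
    {a : E} (hm : Monotone f) (hf : ∀ n, HasSignedIntegral μ (f n) (e n))
    (ha : IsLUB (range e) a) : ∃ g, HasSignedIntegral μ g a := by
  -- Subtracting the first term reduces to non-negative functions.
  set F : ℕ → X → ℝ≥0∞ := fun n x => ENNReal.ofReal (f n x - f 0 x) with hF
  have hFm : ∀ n, Measurable (F n) := fun n =>
    ((hf n).measurable.sub (hf 0).measurable).ennreal_ofReal
  have hsup : HasIntegral μ (fun x => ⨆ n, F n x) (a + -e 0) := by
    refine HasIntegral.iSup hE (a := fun n => e n + -e 0) hFm
      (fun m n hmn x => ENNReal.ofReal_le_ofReal (sub_le_sub_right (hm hmn x) _)) (fun n => ?_)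
      (isLUB_range_add_const ha _)
    rw [← sub_eq_add_neg]
    exact ((hf n).sub hE (hf 0)).hasIntegral hE fun x => sub_nonneg.2 (hm (Nat.zero_le n) x)
  have hGm : Measurable fun x => ⨆ n, F n x := Measurable.iSup hFm
  -- The pointwise supremum can be infinite only on a null set, where `toReal` replaces it by 0.
  have hnull := hsup.measure_eq_top hE hGm
  have h1 : HasIntegral μ (fun x => ENNReal.ofReal (⨆ n, F n x).toReal) (a + -e 0) :=
    hsup.congr_null (hGm (measurableSet_singleton ∞)) hnull
      fun x hx => (ENNReal.ofReal_toReal hx).symm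
  have h2 := h1.hasSignedIntegral hGm.ennreal_toReal fun x => ENNReal.toReal_nonneg
  exact ⟨_, by simpa using h2.add hE (hf 0)⟩

end Integral

/-! ### Negation and cone structure of the up and down sets; from nets to sequences. -/

section Cones

open scoped Pointwise

variable {E : Type*} [AddCommGroup E] [PartialOrder E] [IsOrderedAddMonoid E]

/-- Negation exchanges ups and downs. As the range of `T` is symmetric, this yields half of the
inclusions from the other half. -/
theorem neg_netUp (S : Set E) : -netUp S = netDown (-S) := by
  ext x
  constructor
  · rintro ⟨D, hDS, hne, hdir, hlub⟩
    refine ⟨-D, neg_subset_neg.2 hDS, hne.neg, fun a ha b hb => ?_, ?_⟩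
    · obtain ⟨c, hc, hac, hbc⟩ := hdir _ ha _ hb
      exact ⟨-c, by simpa using hc, neg_le.1 hac, neg_le.1 hbc⟩
    · rw [← isLUB_neg', neg_neg]
      exact hlub
  · rintro ⟨D, hDS, hne, hdir, hglb⟩
    refine ⟨-D, neg_subset.2 hDS, hne.neg, fun a ha b hb => ?_, ?_⟩
    · obtain ⟨c, hc, hac, hbc⟩ := hdir _ ha _ hb
      exact ⟨-c, by simpa using hc, le_neg.1 hac, le_neg.1 hbc⟩
    · rw [isLUB_neg, neg_neg]
      exact hglb

theorem neg_netDown (S : Set E) : -netDown S = netUp (-S) := by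
  rw [neg_eq_iff_eq_neg, neg_netUp, neg_neg]

theorem neg_seqUp (S : Set E) : -seqUp S = seqDown (-S) := by
  ext x
  constructor
  · rintro ⟨u, hu, hm, hlub⟩
    refine ⟨fun n => -u n, fun n => by simpa using hu n, hm.neg, ?_⟩
    simpa using isGLB_range_neg.2 hlub
  · rintro ⟨u, hu, hm, hglb⟩
    exact ⟨fun n => -u n, hu, hm.neg, isLUB_range_neg.2 hglb⟩

theorem neg_seqDown (S : Set E) : -seqDown S = seqUp (-S) := by
  rw [neg_eq_iff_eq_neg, neg_seqUp, neg_neg]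

theorem seqUp_mono {S S' : Set E} (h : S ⊆ S') : seqUp S ⊆ seqUp S' :=
  fun _ ⟨u, hu, hm, hl⟩ => ⟨u, fun n => h (hu n), hm, hl⟩

theorem seqDown_mono {S S' : Set E} (h : S ⊆ S') : seqDown S ⊆ seqDown S' :=
  fun _ ⟨u, hu, hm, hl⟩ => ⟨u, fun n => h (hu n), hm, hl⟩

variable [Module ℝ E] [IsOrderedModule ℝ E]

/-- Closed under addition and multiplication by non-negative scalars. -/
def IsConvexCone (S : Set E) : Prop :=
  (∀ x ∈ S, ∀ y ∈ S, x + y ∈ S) ∧ ∀ c : ℝ, 0 ≤ c → ∀ x ∈ S, c • x ∈ S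

theorem IsConvexCone.netUp {S : Set E} (hS : IsConvexCone S) : IsConvexCone (netUp S) := by
  constructor
  · rintro x ⟨D, hDS, hne, hdir, hlub⟩ y ⟨D', hDS', hne', hdir', hlub'⟩
    refine ⟨D + D', ?_, hne.add hne', ?_, hlub.add hlub'⟩
    · rintro _ ⟨a, ha, b, hb, rfl⟩
      exact hS.1 a (hDS ha) b (hDS' hb)
    · rintro _ ⟨a, ha, b, hb, rfl⟩ _ ⟨a', ha', b', hb', rfl⟩
      obtain ⟨c, hc, hac, hac'⟩ := hdir a ha a' ha'
      obtain ⟨d, hd, hbd, hbd'⟩ := hdir' b hb b' hb'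
      exact ⟨c + d, add_mem_add hc hd, add_le_add hac hbd, add_le_add hac' hbd'⟩
  · rintro r hr x ⟨D, hDS, hne, hdir, hlub⟩
    refine ⟨(fun x => r • x) '' D, ?_, hne.image _, ?_, isLUB_smul_image hr hne hlub⟩
    · rintro _ ⟨a, ha, rfl⟩
      exact hS.2 r hr a (hDS ha)
    · rintro _ ⟨a, ha, rfl⟩ _ ⟨b, hb, rfl⟩
      obtain ⟨c, hc, hac, hbc⟩ := hdir a ha b hb
      exact ⟨_, ⟨c, hc, rfl⟩, smul_le_smul_of_nonneg_left hac hr,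
        smul_le_smul_of_nonneg_left hbc hr⟩

theorem IsConvexCone.neg {S : Set E} (hS : IsConvexCone S) : IsConvexCone (-S) := by
  refine ⟨fun x hx y hy => ?_, fun c hc x hx => ?_⟩
  · rw [Set.mem_neg, neg_add]
    exact hS.1 _ hx _ hy
  · rw [Set.mem_neg, ← smul_neg]
    exact hS.2 c hc _ hx

theorem IsConvexCone.netDown {S : Set E} (hS : IsConvexCone S) : IsConvexCone (netDown S) := by
  rw [← neg_neg S, ← neg_netUp]
  exact hS.neg.netUp.neg

theorem IsConvexCone.elementaryIntegral_mem {X : Type*} [MeasurableSpace X]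
    {μ : FinitePosMeasure X E} {S : Set E} (hS : IsConvexCone S)
    (h : ∀ A, MeasurableSet A → μ.toFun A ∈ S) (φ : SimpleFunc X ℝ≥0) :
    elementaryIntegral μ φ ∈ S := by
  refine Finset.sum_induction _ (· ∈ S) (fun a b ha hb => hS.1 a ha b hb) ?_ fun r _ =>
    hS.2 r r.2 _ (h _ (φ.measurableSet_preimage _))
  simpa using hS.2 0 le_rfl _ (h ∅ MeasurableSet.empty)

/-- Under the countable sup property, the supremum of an increasing family that is closed under
finite suprema is attained along an increasing sequence. -/
theorem CountableSupProperty.exists_monotone_seq (hC : CountableSupProperty E) {ι : Type*}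
    [SemilatticeSup ι] {P : Set ι} (hne : P.Nonempty) (hP : SupClosed P) {F : ι → E}
    (hF : MonotoneOn F P) {x : E} (hx : IsLUB (F '' P) x) :
    ∃ u : ℕ → ι, Monotone u ∧ (∀ n, u n ∈ P) ∧ IsLUB (range fun n => F (u n)) x := by
  obtain ⟨i₀, hi₀⟩ := hne
  -- The countable sup property concerns only positive nets: restrict to the cofinal part above `i₀`
  -- and translate by `-F i₀`.
  set Q : Set ι := {i ∈ P | i₀ ≤ i} with hQ
  have hlub : IsLUB ((fun i => F i + -F i₀) '' Q) (x + -F i₀) := by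
    have : IsLUB (F '' Q) x := by
      refine ⟨fun y hy => hx.1 (image_mono (sep_subset _ _) hy), fun b hb => hx.2 ?_⟩
      rintro _ ⟨i, hi, rfl⟩
      have hsup := hP hi hi₀
      exact (hF hi hsup le_sup_left).trans (hb ⟨_, ⟨hsup, le_sup_right⟩, rfl⟩)
    have h := isLUB_add_const this (-F i₀)
    rwa [image_image] at h
  have hQne : Q.Nonempty := ⟨i₀, hi₀, le_rfl⟩
  have hdir : DirectedOn (· ≤ ·) ((fun i => F i + -F i₀) '' Q) := by
    rintro _ ⟨i, hi, rfl⟩ _ ⟨j, hj, rfl⟩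
    have hsup := hP hi.1 hj.1
    exact ⟨_, ⟨i ⊔ j, ⟨hsup, hi.2.trans le_sup_left⟩, rfl⟩,
      add_le_add_left (hF hi.1 hsup le_sup_left) _, add_le_add_left (hF hj.1 hsup le_sup_right) _⟩
  have hpos : ∀ d ∈ (fun i => F i + -F i₀) '' Q, 0 ≤ d := by
    rintro _ ⟨i, hi, rfl⟩
    have := hF hi₀ hi.1 hi.2
    simpa [← sub_eq_add_neg] using this
  obtain ⟨C, hCD, hCne, hCc, hCl⟩ := hC _ _ (hQne.image _) hdir hpos hlub
  obtain ⟨c, rfl⟩ := hCc.exists_eq_range hCne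
  have hch : ∀ n, ∃ i ∈ Q, F i + -F i₀ = c n := fun n => hCD ⟨n, rfl⟩
  choose i hiQ hic using hch
  have hmem : ∀ n, partialSups i n ∈ P := fun n => by
    induction n with
    | zero => simpa using (hiQ 0).1
    | succ n ih =>
      rw [partialSups_add_one]
      exact hP ih (hiQ _).1
  -- The countable family is made increasing by suprema of indices, since suprema of values need not
  -- exist in `E`.
  refine ⟨partialSups i, partialSups_monotone i, hmem, ?_, fun b hb => ?_⟩
  · rintro _ ⟨n, rfl⟩
    exact hx.1 ⟨_, hmem n, rfl⟩
  · have h := hCl.2 (show b + -F i₀ ∈ upperBounds (range c) by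
      rintro _ ⟨n, rfl⟩
      rw [← hic]
      refine add_le_add_left (?_ : F (i n) ≤ b) _
      exact (hF (hiQ n).1 (hmem n) (le_partialSups i n)).trans (hb ⟨n, rfl⟩))
    simpa using h

end Cones

/-! ### Bounded functions, and the range of the integral operator. -/

section Bounded

variable {X E : Type*} [MeasurableSpace X] [AddCommGroup E] [PartialOrder E]
  [IsOrderedAddMonoid E] [Module ℝ E] [IsOrderedModule ℝ E] {μ : FinitePosMeasure X E}

theorem hasSignedIntegral_simpleFunc (φ : SimpleFunc X ℝ≥0) :
    HasSignedIntegral μ (fun x => (φ x : ℝ)) (elementaryIntegral μ φ) :=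
  HasIntegral.hasSignedIntegral φ.measurable.coe_nnreal_real (fun x => (φ x).2)
    (by simpa using hasIntegral_simpleFunc φ)

theorem elementaryIntegral_const (c : ℝ≥0) :
    elementaryIntegral μ (SimpleFunc.const X c) = (c : ℝ) • μ.toFun univ := by
  rw [← elementaryIntegral_indicator μ c MeasurableSet.univ]
  congr 1
  ext x; simp

theorem exists_hasSignedIntegral_of_mem_boundedMeasurable (hE : MonotoneComplete E) {f : X → ℝ}
    (hf : f ∈ boundedMeasurable X) :
    ∃ (M : ℝ≥0) (φ : ℕ → SimpleFunc X ℝ≥0) (p : E), Monotone φ ∧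
      IsLUB (range fun n => elementaryIntegral μ (φ n)) p ∧
      HasSignedIntegral μ f (p - (M : ℝ) • μ.toFun univ) := by
  obtain ⟨hfm, M, hM⟩ := hf
  have hM0 : ∀ x, |f x| ≤ M.toNNReal := fun x => (hM x).trans (Real.le_coe_toNNReal M)
  generalize M.toNNReal = M at hM0
  set g : X → ℝ := fun x => f x + M with hg
  have hgm : Measurable g := hfm.add_const _
  have hg0 : ∀ x, 0 ≤ g x := fun x => by linarith [(abs_le.1 (hM0 x)).1]
  -- Since `0 ≤ f + M ≤ 2M`, the constant `2M` is an integrable majorant.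
  obtain ⟨p, hp⟩ := HasIntegral.exists_of_le hE (f := fun x => ENNReal.ofReal (g x))
    hgm.ennreal_ofReal (hasIntegral_simpleFunc (μ := μ) (SimpleFunc.const X (M + M))) fun x => by
      refine ENNReal.ofReal_le_of_le_toReal ?_
      simp only [hg, SimpleFunc.coe_const, Function.const_apply, ENNReal.coe_toReal,
        NNReal.coe_add]
      linarith [(abs_le.1 (hM0 x)).2]
  obtain ⟨φ, hφ, hφg⟩ := exists_simpleFunc_monotone hgm.ennreal_ofReal
  refine ⟨M, φ, p, hφ, (hasIntegral_iff_of_monotone hE hφ hφg).1 hp, ?_⟩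
  have h := (hp.hasSignedIntegral hgm hg0).sub hE
    (hasSignedIntegral_simpleFunc (SimpleFunc.const X M))
  rw [elementaryIntegral_const] at h
  simpa [hg] using h

theorem boundedMeasurable_subset_L1 (hE : MonotoneComplete E) : boundedMeasurable X ⊆ L1 μ :=
  fun _ hf =>
    let ⟨_, _, _, _, _, h⟩ := exists_hasSignedIntegral_of_mem_boundedMeasurable hE hf
    (h.mem_L1_and_integral_eq hE).1

/-- The shift by `M` must be undone inside `S`. A convex cone need not be symmetric, hence the
separate assumption on `-μ.toFun univ`. -/
theorem integral_mem_seqUp (hE : MonotoneComplete E) {S : Set E} (hS : IsConvexCone S)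
    (h : ∀ A, MeasurableSet A → μ.toFun A ∈ S) (h' : -μ.toFun univ ∈ S) {f : X → ℝ}
    (hf : f ∈ boundedMeasurable X) : integral μ f ∈ seqUp S := by
  obtain ⟨M, φ, p, hφ, hp, hfp⟩ :=
    exists_hasSignedIntegral_of_mem_boundedMeasurable (μ := μ) hE hf
  rw [(hfp.mem_L1_and_integral_eq hE).2]
  refine ⟨fun n => elementaryIntegral μ (φ n) + -((M : ℝ) • μ.toFun univ), fun n => ?_, ?_, ?_⟩
  · rw [← smul_neg]
    exact hS.1 _ (hS.elementaryIntegral_mem h _) _ (hS.2 _ M.2 _ h')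
  · exact (monotone_elementaryIntegral hφ).add_const _
  · rw [sub_eq_add_neg]
    exact isLUB_range_add_const hp _

theorem neg_mem_boundedMeasurable {f : X → ℝ} (hf : f ∈ boundedMeasurable X) :
    (fun x => -f x) ∈ boundedMeasurable X :=
  ⟨hf.1.neg, hf.2.imp fun M hM x => by simpa using hM x⟩

theorem integral_neg (hE : MonotoneComplete E) {f : X → ℝ} (hf : f ∈ L1 μ) :
    integral μ (fun x => -f x) = -integral μ f :=
  ((hasSignedIntegral_of_mem_L1 hE hf).neg.mem_L1_and_integral_eq hE).2

/-- If the integral operator preserves the lattice structure, then its range is closed under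
suprema of increasing sequences. -/
theorem seqUp_integral_subset (hE : MonotoneComplete E)
    (hL : PreservesLatticeStructure (integralOperator μ)) :
    seqUp (integral μ '' L1 μ) ⊆ integral μ '' L1 μ := by
  rintro x ⟨u, hu, hm, hlub⟩
  choose f hf hfu using hu
  have hfs : ∀ n, HasSignedIntegral μ (f n) (u n) := fun n =>
    hfu n ▸ hasSignedIntegral_of_mem_L1 hE (hf n)
  -- The `f n` need not increase although their integrals do. Lattice preservation gives the partial
  -- suprema the integral `u n ∨ u (n + 1) = u (n + 1)`, so they form an increasing sequence with
  -- unchanged integrals.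
  have key : ∀ n, HasSignedIntegral μ (partialSups f n) (u n) := fun n => by
    induction n with
    | zero => simpa using hfs 0
    | succ n ih =>
      rw [partialSups_add_one]
      obtain ⟨d, hd⟩ := ih.exists_sup hE (hfs (n + 1))
      have h1 := ih.mem_L1_and_integral_eq hE
      have h2 := hd.mem_L1_and_integral_eq hE
      have h3 : IsLUB {integral μ (partialSups f n), integral μ (f (n + 1))}
          (integral μ (partialSups f n ⊔ f (n + 1))) := by
        refine hL ⟨_, h1.1⟩ ⟨_, hf (n + 1)⟩ ⟨_, h2.1⟩ ⟨?_, ?_⟩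
        · rintro _ (rfl | rfl)
          · exact Subtype.mk_le_mk.2 le_sup_left
          · exact Subtype.mk_le_mk.2 le_sup_right
        · rintro ⟨w, hw⟩ hwub
          exact Subtype.mk_le_mk.2 (sup_le (Subtype.mk_le_mk.1 (hwub (Or.inl rfl)))
            (Subtype.mk_le_mk.1 (hwub (Or.inr rfl))))
      rw [h1.2, h2.2, hfu] at h3
      have h4 : IsLUB {u n, u (n + 1)} (u (n + 1)) := by
        refine IsGreatest.isLUB ⟨Or.inr rfl, ?_⟩
        rintro _ (rfl | rfl)
        · exact hm n.le_succ
        · exact le_rfl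
      rwa [← h3.unique h4]
  obtain ⟨g, hg⟩ := HasSignedIntegral.exists_of_monotone hE (partialSups_monotone f) key hlub
  exact ⟨g, hg.mem_L1_and_integral_eq hE⟩

open scoped Pointwise in
theorem neg_integral_image_L1 (hE : MonotoneComplete E) :
    -(integral μ '' L1 μ) = integral μ '' L1 μ := by
  have key : -(integral μ '' L1 μ) ⊆ integral μ '' L1 μ := by
    rintro x ⟨f, hf, hx⟩
    refine ⟨fun x => -f x, ((hasSignedIntegral_of_mem_L1 hE hf).neg.mem_L1_and_integral_eq hE).1, ?_⟩
    rw [integral_neg hE hf, hx, neg_neg]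
  exact key.antisymm (by simpa using neg_subset_neg.2 key)

theorem seqDown_integral_subset (hE : MonotoneComplete E)
    (hL : PreservesLatticeStructure (integralOperator μ)) :
    seqDown (integral μ '' L1 μ) ⊆ integral μ '' L1 μ := by
  rw [← neg_integral_image_L1 hE, ← neg_seqUp, Set.neg_subset_neg]
  exact seqUp_integral_subset hE hL

theorem integral_L1_subset (hE : MonotoneComplete E) (hB : L1EqBounded μ) :
    integral μ '' L1 μ ⊆ integral μ '' boundedMeasurable X := by
  rintro _ ⟨f, hf, rfl⟩
  have h : aeClass μ f ∈ aeClass μ '' boundedMeasurable X := by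
    rw [← hB]; exact ⟨f, hf, rfl⟩
  obtain ⟨b, hb, hbf⟩ := h
  have hfb : f ∈ aeClass μ b := by
    rw [hbf]; exact ⟨hf.1, by simp [μ.empty]⟩
  have hbs := hasSignedIntegral_of_mem_L1 hE (boundedMeasurable_subset_L1 (μ := μ) hE hb)
  have hfs := hbs.congr_null hE (measurableSet_eq_fun hb.1 hf.1).compl hfb.2
    (fun x hx => by simpa using hx) hf.1
  exact ⟨b, hb, (hfs.mem_L1_and_integral_eq hE).2.symm⟩

end Bounded

/-! ### Approximation of measures and integrals by values of `T`. -/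

section Approximation

variable {X E : Type*} [TopologicalSpace X] [MeasurableSpace X] [AddCommGroup E] [PartialOrder E]
  [IsOrderedAddMonoid E] [Module ℝ E] [IsOrderedModule ℝ E] {μ : FinitePosMeasure X E}
  {T : C_c(X, ℝ) →ₗ[ℝ] E}

theorem monotone_of_nonneg (hT : ∀ f : C_c(X, ℝ), 0 ≤ f → 0 ≤ T f) : Monotone T := fun f g hfg => by
  rw [← sub_nonneg, ← map_sub]
  exact hT _ (fun x => by simpa using hfg x)

theorem isConvexCone_range : IsConvexCone (range T) := by
  constructor
  · rintro _ ⟨f, rfl⟩ _ ⟨g, rfl⟩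
    exact ⟨f + g, map_add T f g⟩
  · rintro c - _ ⟨f, rfl⟩
    exact ⟨c • f, map_smul T c f⟩

open scoped Pointwise in
theorem neg_range_linearMap : -range T = range T := by
  ext x
  constructor
  · rintro ⟨f, hf⟩
    exact ⟨-f, by rw [map_neg, hf, neg_neg]⟩
  · rintro ⟨f, rfl⟩
    exact ⟨-f, map_neg T f⟩

theorem supClosed_subordinateTo (V : Set X) : SupClosed {f : C_c(X, ℝ) | SubordinateTo f V} := by
  rintro f ⟨hf, hfV⟩ g ⟨hg, hgV⟩
  refine ⟨fun x => ⟨(hf x).1.trans le_sup_left, sup_le (hf x).2 (hg x).2⟩, ?_⟩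
  -- Off both supports the supremum vanishes, so its support lies in their closed union.
  refine (closure_minimal ?_ ((isClosed_tsupport f).union (isClosed_tsupport g))).trans
    (union_subset hfV hgV)
  intro x hx
  by_contra hcon
  rw [mem_union, not_or] at hcon
  refine hx ?_
  change f x ⊔ g x = 0
  rw [image_eq_zero_of_notMem_tsupport hcon.1, image_eq_zero_of_notMem_tsupport hcon.2, sup_idem]

theorem subordinateTo_nonempty (V : Set X) : {f : C_c(X, ℝ) | SubordinateTo f V}.Nonempty :=
  ⟨0, fun x => by simp, by simp [tsupport]⟩

theorem infClosed_dominates (K : Set X) : InfClosed {f : C_c(X, ℝ) | Dominates K f} := by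
  rintro f ⟨hf, hfK⟩ g ⟨hg, hgK⟩
  refine ⟨fun x => ⟨le_inf (hf x).1 (hg x).1, inf_le_left.trans (hf x).2⟩, fun x hx => ?_⟩
  change f x ⊓ g x = 1
  rw [hfK x hx, hgK x hx, inf_idem]

theorem dominates_nonempty [T2Space X] [LocallyCompactSpace X] {K : Set X} (hK : IsCompact K) :
    {f : C_c(X, ℝ) | Dominates K f}.Nonempty := by
  obtain ⟨f, hf1, -, hfc, hf⟩ :=
    exists_continuous_one_zero_of_isCompact hK isClosed_empty (disjoint_empty K)
  exact ⟨⟨f, hfc⟩, fun x => hf x, hf1⟩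

theorem toFun_mem_netUp (hT : Monotone T) {V : Set X}
    (h : IsLUB (T '' {f | SubordinateTo f V}) (μ.toFun V)) : μ.toFun V ∈ netUp (range T) := by
  refine ⟨_, image_subset_range _ _, (subordinateTo_nonempty V).image _, ?_, h⟩
  rintro _ ⟨f, hf, rfl⟩ _ ⟨g, hg, rfl⟩
  exact ⟨_, ⟨f ⊔ g, supClosed_subordinateTo V hf hg, rfl⟩, hT le_sup_left, hT le_sup_right⟩

theorem toFun_mem_netDown [T2Space X] [LocallyCompactSpace X] (hT : Monotone T) {K : Set X}
    (hK : IsCompact K) (h : IsGLB (T '' {f | Dominates K f}) (μ.toFun K)) :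
    μ.toFun K ∈ netDown (range T) := by
  refine ⟨_, image_subset_range _ _, (dominates_nonempty hK).image _, ?_, h⟩
  rintro _ ⟨f, hf, rfl⟩ _ ⟨g, hg, rfl⟩
  exact ⟨_, ⟨f ⊓ g, infClosed_dominates K hf hg, rfl⟩, hT inf_le_left, hT inf_le_right⟩

theorem toFun_mem_netDown_netUp [BorelSpace X] (hT : Monotone T)
    (hopen : ∀ V : Set X, IsOpen V → IsLUB (T '' {f | SubordinateTo f V}) (μ.toFun V))
    {A : Set X} (hA : OuterRegularAt μ A) : μ.toFun A ∈ netDown (netUp (range T)) := by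
  have hne : {V | IsOpen V ∧ A ⊆ V}.Nonempty := ⟨univ, isOpen_univ, subset_univ A⟩
  refine ⟨_, ?_, hne.image _, ?_, hA⟩
  · rintro _ ⟨V, hV, rfl⟩
    exact toFun_mem_netUp hT (hopen V hV.1)
  · rintro _ ⟨V, hV, rfl⟩ _ ⟨W, hW, rfl⟩
    have hVW := hV.1.inter hW.1
    exact ⟨_, ⟨V ∩ W, ⟨hVW, subset_inter hV.2 hW.2⟩, rfl⟩,
      μ.mono hVW.measurableSet hV.1.measurableSet inter_subset_left,
      μ.mono hVW.measurableSet hW.1.measurableSet inter_subset_right⟩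

theorem toFun_mem_netUp_netDown [T2Space X] [LocallyCompactSpace X] [BorelSpace X]
    (hT : Monotone T)
    (hcompact : ∀ K : Set X, IsCompact K → IsGLB (T '' {f | Dominates K f}) (μ.toFun K))
    {A : Set X} (hA : InnerRegularAt μ A) : μ.toFun A ∈ netUp (netDown (range T)) := by
  have hne : {K | IsCompact K ∧ K ⊆ A}.Nonempty := ⟨∅, isCompact_empty, empty_subset A⟩
  refine ⟨_, ?_, hne.image _, ?_, hA⟩
  · rintro _ ⟨K, hK, rfl⟩
    exact toFun_mem_netDown hT hK.1 (hcompact K hK.1)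
  · rintro _ ⟨K, hK, rfl⟩ _ ⟨L, hL, rfl⟩
    have hKL := hK.1.union hL.1
    exact ⟨_, ⟨K ∪ L, ⟨hKL, union_subset hK.2 hL.2⟩, rfl⟩,
      μ.mono hK.1.measurableSet hKL.measurableSet subset_union_left,
      μ.mono hL.1.measurableSet hKL.measurableSet subset_union_right⟩

/-- `h` is integrable with integral `e`, which is the infimum of the values of `T` along a
decreasing sequence in `C_c(X)` above `h`. -/
def IsUpperApproximable (μ : FinitePosMeasure X E) (T : C_c(X, ℝ) →ₗ[ℝ] E) (h : X → ℝ) (e : E) :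
    Prop :=
  HasSignedIntegral μ h e ∧ ∃ g : ℕ → C_c(X, ℝ), Antitone g ∧ (∀ n x, h x ≤ g n x) ∧
    IsGLB (range fun n => T (g n)) e

theorem IsUpperApproximable.add (hE : MonotoneComplete E) (hT : Monotone T) {h h' : X → ℝ}
    {e e' : E} (H : IsUpperApproximable μ T h e) (H' : IsUpperApproximable μ T h' e') :
    IsUpperApproximable μ T (fun x => h x + h' x) (e + e') := by
  obtain ⟨hi, g, hg, hle, hglb⟩ := H
  obtain ⟨hi', g', hg', hle', hglb'⟩ := H'
  refine ⟨hi.add hE hi', fun n => g n + g' n, hg.add hg',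
    fun n x => add_le_add (hle n x) (hle' n x), ?_⟩
  simp only [map_add]
  exact isGLB_range_add (hT.comp_antitone hg) (hT.comp_antitone hg') hglb hglb'

/-- The pointwise estimate `g ∨ g' - h ∨ h' ≤ (g - h) + (g' - h')`, valid because `g` and `g'`
dominate `h` and `h'`, bounds the error of the supremum by the sum of two errors with infimum 0. -/
theorem IsUpperApproximable.exists_sup (hE : MonotoneComplete E) (hT : Monotone T)
    (hTi : ∀ f : C_c(X, ℝ), HasSignedIntegral μ f (T f)) {h h' : X → ℝ}
    {e e' : E} (H : IsUpperApproximable μ T h e) (H' : IsUpperApproximable μ T h' e') :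
    ∃ d, IsUpperApproximable μ T (h ⊔ h') d := by
  obtain ⟨hi, g, hg, hle, hglb⟩ := H
  obtain ⟨hi', g', hg', hle', hglb'⟩ := H'
  obtain ⟨d, hd⟩ := hi.exists_sup hE hi'
  refine ⟨d, hd, fun n => g n ⊔ g' n, hg.sup hg', fun n x => sup_le_sup (hle n x) (hle' n x),
    ?_, fun c hc => ?_⟩
  · rintro _ ⟨n, rfl⟩
    exact hd.mono hE (hTi _) fun x => sup_le_sup (hle n x) (hle' n x)
  · have hsum := isGLB_range_add (hT.comp_antitone hg) (hT.comp_antitone hg') hglb hglb'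
    have h1 : c - d + (e + e') ≤ e + e' := by
      refine hsum.2 ?_
      rintro _ ⟨n, rfl⟩
      have h2 := ((hTi (g n ⊔ g' n)).sub hE hd).mono hE
        (((hTi (g n)).sub hE hi).add hE ((hTi (g' n)).sub hE hi')) fun x => ?_
      · have h3 : T (g n ⊔ g' n) - d + (e + e') ≤ T (g n) + T (g' n) := by
          rw [← le_sub_iff_add_le]
          refine h2.trans_eq ?_
          abel
        refine le_trans ?_ h3
        exact add_le_add_left (sub_le_sub_right (hc ⟨n, rfl⟩) d) _
      · change (g n x ⊔ g' n x) - (h x ⊔ h' x) ≤ g n x - h x + (g' n x - h' x)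
        rw [sub_le_iff_le_add, sup_le_iff]
        have a1 := hle n x
        have a2 := hle' n x
        constructor
        · linarith [le_sup_left (a := h x) (b := h' x)]
        · linarith [le_sup_right (a := h x) (b := h' x)]
    simpa using h1

/-- `e` is the supremum of the integrals of an increasing sequence below `f` of functions that can
be approximated from above. -/
def IsLowerApproximable (μ : FinitePosMeasure X E) (T : C_c(X, ℝ) →ₗ[ℝ] E) (f : X → ℝ) (e : E) :
    Prop :=
  ∃ (h : ℕ → X → ℝ) (a : ℕ → E), Monotone h ∧ (∀ n, IsUpperApproximable μ T (h n) (a n)) ∧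
    (∀ n x, h n x ≤ f x) ∧ IsLUB (range a) e

theorem IsLowerApproximable.add (hE : MonotoneComplete E) (hT : Monotone T) {f f' : X → ℝ}
    {e e' : E} (H : IsLowerApproximable μ T f e) (H' : IsLowerApproximable μ T f' e') :
    IsLowerApproximable μ T (fun x => f x + f' x) (e + e') := by
  obtain ⟨h, a, hm, hh, hle, hlub⟩ := H
  obtain ⟨h', a', hm', hh', hle', hlub'⟩ := H'
  refine ⟨fun n x => h n x + h' n x, fun n => a n + a' n, hm.add hm',
    fun n => (hh n).add hE hT (hh' n), fun n x => add_le_add (hle n x) (hle' n x),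
    isLUB_range_add ?_ ?_ hlub hlub'⟩
  · exact fun m n hmn => (hh m).1.mono hE (hh n).1 (hm hmn)
  · exact fun m n hmn => (hh' m).1.mono hE (hh' n).1 (hm' hmn)

variable [T2Space X] [LocallyCompactSpace X] [BorelSpace X]

theorem isUpperApproximable_const_indicator (hC : CountableSupProperty E) (hT : Monotone T)
    {K : Set X} (hK : IsCompact K) (hKT : IsGLB (T '' {f | Dominates K f}) (μ.toFun K)) (c : ℝ≥0) :
    IsUpperApproximable μ T (K.indicator fun _ => (c : ℝ)) ((c : ℝ) • μ.toFun K) := by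
  constructor
  · have h := hasSignedIntegral_simpleFunc (μ := μ) (SimpleFunc.piecewise K hK.measurableSet
      (SimpleFunc.const X c) (SimpleFunc.const X 0))
    rw [elementaryIntegral_indicator] at h
    convert h using 2 with x
    by_cases hx : x ∈ K <;> simp [hx]
  -- The countable sup property speaks of suprema, so it is applied to `-T` on the order dual.
  · have hlub : IsLUB ((fun f : (C_c(X, ℝ))ᵒᵈ => -T (OrderDual.ofDual f)) ''
        (OrderDual.ofDual ⁻¹' {f | Dominates K f})) (-μ.toFun K) := by
      rw [← isLUB_neg', ← Set.image_neg_eq_neg, image_image] at hKT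
      exact hKT
    obtain ⟨u, hu, huK, hul⟩ := hC.exists_monotone_seq (ι := (C_c(X, ℝ))ᵒᵈ)
      (P := OrderDual.ofDual ⁻¹' {f | Dominates K f}) (dominates_nonempty hK)
      (fun f hf g hg => infClosed_dominates K hf hg) (fun f _ g _ hfg => neg_le_neg (hT hfg)) hlub
    rw [isLUB_range_neg] at hul
    refine ⟨fun n => (c : ℝ) • OrderDual.ofDual (u n), fun m n hmn x => ?_, fun n x => ?_, ?_⟩
    · exact mul_le_mul_of_nonneg_left (hu hmn x) c.2
    · obtain ⟨h1, h2⟩ := huK n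
      change _ ≤ (c : ℝ) * (OrderDual.ofDual (u n)) x
      by_cases hx : x ∈ K
      · simp [hx, h2 x hx]
      · simpa [hx] using mul_nonneg c.2 (h1 x).1
    · simp only [map_smul]
      exact isGLB_range_smul c.2 hul

/-- Inner regularity at Borel sets, made sequential, handles multiples of indicators; sums of
approximations handle the rest. -/
theorem isLowerApproximable_simpleFunc (hE : MonotoneComplete E) (hC : CountableSupProperty E)
    (hT : Monotone T)
    (hcompact : ∀ K : Set X, IsCompact K → IsGLB (T '' {f | Dominates K f}) (μ.toFun K))
    (hinner : ∀ A : Set X, MeasurableSet A → InnerRegularAt μ A) (φ : SimpleFunc X ℝ≥0) :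
    IsLowerApproximable μ T (fun x => (φ x : ℝ)) (elementaryIntegral μ φ) := by
  induction φ using SimpleFunc.induction with
  | @const c A hA =>
    obtain ⟨K, hK, hKA, hKl⟩ := hC.exists_monotone_seq (P := {K | IsCompact K ∧ K ⊆ A})
      ⟨∅, isCompact_empty, empty_subset A⟩
      (fun K hK L hL => ⟨hK.1.union hL.1, union_subset hK.2 hL.2⟩)
      (fun K hK L hL hKL => μ.mono hK.1.measurableSet hL.1.measurableSet hKL) (hinner A hA)
    refine ⟨fun n => (K n).indicator fun _ => (c : ℝ), fun n => (c : ℝ) • μ.toFun (K n), ?_, ?_,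
      ?_, ?_⟩
    · exact fun m n hmn x => indicator_le_indicator_of_subset (hK hmn) (fun _ => c.2) x
    · exact fun n => isUpperApproximable_const_indicator hC hT (hKA n).1 (hcompact _ (hKA n).1) c
    · intro n x
      by_cases hx : x ∈ K n
      · simp [hx, (hKA n).2 hx]
      · exact (indicator_of_notMem hx _).trans_le (NNReal.coe_nonneg _)
    · rw [elementaryIntegral_indicator]
      exact isLUB_range_smul c.2 hKl
  | @add f g _ hf hg =>
    rw [elementaryIntegral_add]
    simpa using hf.add hE hT hg

/-- A diagonal argument: with `h j m` increasing in `m` towards `φ j` in integral, take `H m` as the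
maximum of the `h j m` over `j ≤ m`. It increases, stays below `φ m`, and dominates every `h k m`
with `k ≤ m`. -/
theorem exists_seq_isUpperApproximable (hE : MonotoneComplete E) (hT : Monotone T)
    (hTi : ∀ f : C_c(X, ℝ), HasSignedIntegral μ f (T f)) {φ : ℕ → SimpleFunc X ℝ≥0}
    (hφ : Monotone φ)
    (hlow : ∀ n, IsLowerApproximable μ T (fun x => (φ n x : ℝ)) (elementaryIntegral μ (φ n)))
    {p : E} (hp : IsLUB (range fun n => elementaryIntegral μ (φ n)) p) :
    ∃ (H : ℕ → X → ℝ) (a : ℕ → E), Monotone H ∧ (∀ n, IsUpperApproximable μ T (H n) (a n)) ∧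
      IsLUB (range a) p := by
  choose h b hm hh hle hlub using hlow
  set H : ℕ → X → ℝ := fun m =>
    (Finset.range (m + 1)).sup' Finset.nonempty_range_add_one fun j => h j m with hH
  have hex : ∀ m, ∃ d, IsUpperApproximable μ T (H m) d := fun m =>
    Finset.sup'_induction (p := fun f => ∃ d, IsUpperApproximable μ T f d) _ _
      (fun f ⟨_, hf⟩ g ⟨_, hg⟩ => hf.exists_sup hE hT hTi hg) fun j _ => ⟨_, hh j m⟩
  choose a ha using hex
  have hleH : ∀ k m, k ≤ m → h k m ≤ H m := fun k m hkm =>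
    Finset.le_sup' (fun j => h j m) (Finset.mem_range.2 (Nat.lt_succ_of_le hkm))
  have hHm : Monotone H := fun m n hmn => Finset.sup'_le _ _ fun j hj =>
    (hm j hmn).trans (hleH j n (by rw [Finset.mem_range] at hj; omega))
  have hHφ : ∀ m, H m ≤ fun x => (φ m x : ℝ) := fun m => Finset.sup'_le _ _ fun j hj x =>
    (hle j m x).trans (NNReal.coe_le_coe.2 (hφ (Nat.le_of_lt_succ (Finset.mem_range.1 hj)) x))
  refine ⟨H, a, hHm, ha, ?_, fun c hc => hp.2 ?_⟩
  · rintro _ ⟨m, rfl⟩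
    exact ((ha m).1.mono hE (hasSignedIntegral_simpleFunc (φ m)) (hHφ m)).trans (hp.1 ⟨m, rfl⟩)
  · rintro _ ⟨k, rfl⟩
    refine (hlub k).2 ?_
    rintro _ ⟨m, rfl⟩
    -- The index `max k m` is late enough for row `k` to enter the diagonal maximum and for its
    -- entry to exceed `h k m`.
    refine le_trans ?_ (hc ⟨max k m, rfl⟩)
    exact (hh k m).1.mono hE (ha _).1
      fun x => (hm k (le_max_right k m) x).trans (hleH k _ (le_max_left k m) x)

theorem integral_mem_seqUp_seqDown (hE : MonotoneComplete E) (hC : CountableSupProperty E)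
    (hT : Monotone T) (hTi : ∀ f : C_c(X, ℝ), HasSignedIntegral μ f (T f))
    (huniv : IsLUB (T '' {f | SubordinateTo f univ}) (μ.toFun univ))
    (hcompact : ∀ K : Set X, IsCompact K → IsGLB (T '' {f | Dominates K f}) (μ.toFun K))
    (hinner : ∀ A : Set X, MeasurableSet A → InnerRegularAt μ A) {f : X → ℝ}
    (hf : f ∈ boundedMeasurable X) : integral μ f ∈ seqUp (seqDown (range T)) := by
  obtain ⟨M, φ, p, hφ, hp, hfp⟩ :=
    exists_hasSignedIntegral_of_mem_boundedMeasurable (μ := μ) hE hf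
  rw [(hfp.mem_L1_and_integral_eq hE).2]
  obtain ⟨H, a, hH, ha, hap⟩ := exists_seq_isUpperApproximable hE hT hTi hφ
    (fun n => isLowerApproximable_simpleFunc hE hC hT hcompact hinner (φ n)) hp
  -- Constants need not have compact support, so `M • μ(X)` is reached through functions `u k` whose
  -- values increase to `μ(X)`; negated, they decrease and join the inner infimum.
  obtain ⟨u, hu, -, hul⟩ := hC.exists_monotone_seq (subordinateTo_nonempty univ)
    (supClosed_subordinateTo univ) (hT.monotoneOn _) huniv
  refine ⟨fun n => a n + -((M : ℝ) • μ.toFun univ), fun n => ?_, ?_, ?_⟩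
  · obtain ⟨-, g, hg, -, hgl⟩ := ha n
    have hMu : Antitone fun k => -((M : ℝ) • T (u k)) := fun i j hij =>
      neg_le_neg (smul_le_smul_of_nonneg_left (hT (hu hij)) M.2)
    refine ⟨fun k => T (g k) + -((M : ℝ) • T (u k)), fun k => ⟨g k + -((M : ℝ) • u k), ?_⟩,
      (hT.comp_antitone hg).add hMu, ?_⟩
    · rw [map_add, map_neg, map_smul]
    · exact isGLB_range_add (hT.comp_antitone hg) hMu hgl
        (isGLB_range_neg.2 (isLUB_range_smul M.2 hul))
  · exact Monotone.add_const (fun m n hmn => (ha m).1.mono hE (ha n).1 (hH hmn)) _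
  · rw [sub_eq_add_neg]
    exact isLUB_range_add_const hap _

end Approximation

end UpsAndDowns

/-! ### The main theorem. -/

open UpsAndDowns Pointwise in
theorem mainTheorem7
    {X : Type*} [TopologicalSpace X] [T2Space X] [LocallyCompactSpace X]
    [MeasurableSpace X] [BorelSpace X]
    {E : Type*} [AddCommGroup E] [PartialOrder E] [IsOrderedAddMonoid E]
    [Module ℝ E] [IsOrderedModule ℝ E]
    (hE : UpsAndDowns.MonotoneComplete E)
    (T : C_c(X, ℝ) →ₗ[ℝ] E) (hT : ∀ f : C_c(X, ℝ), 0 ≤ f → 0 ≤ T f)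
    (μ : UpsAndDowns.FinitePosMeasure X E)
    (hreg : UpsAndDowns.RegularBorel μ)
    (hrep : UpsAndDowns.Represents μ T)
    (hopen : ∀ V : Set X, IsOpen V →
      IsLUB (T '' {f | UpsAndDowns.SubordinateTo f V}) (μ.toFun V))
    (hcompact : ∀ K : Set X, IsCompact K →
      IsGLB (T '' {f | UpsAndDowns.Dominates K f}) (μ.toFun K))
    (hinner : ∀ A : Set X, MeasurableSet A → UpsAndDowns.InnerRegularAt μ A) :
    (UpsAndDowns.boundedMeasurable X ⊆ UpsAndDowns.L1 μ) ∧
    (UpsAndDowns.integral μ '' UpsAndDowns.boundedMeasurable X ⊆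
      UpsAndDowns.seqUp (UpsAndDowns.netDown (UpsAndDowns.netUp (range T)))) ∧
    (UpsAndDowns.integral μ '' UpsAndDowns.boundedMeasurable X ⊆
      UpsAndDowns.seqDown (UpsAndDowns.netUp (UpsAndDowns.netDown (range T)))) ∧
    (UpsAndDowns.integral μ '' UpsAndDowns.boundedMeasurable X ⊆
      UpsAndDowns.seqUp (UpsAndDowns.netUp (UpsAndDowns.netDown (range T)))) ∧
    (UpsAndDowns.integral μ '' UpsAndDowns.boundedMeasurable X ⊆
      UpsAndDowns.seqDown (UpsAndDowns.netDown (UpsAndDowns.netUp (range T)))) ∧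
    (UpsAndDowns.CountableSupProperty E →
      UpsAndDowns.PreservesLatticeStructure (UpsAndDowns.integralOperator μ) →
        (UpsAndDowns.integral μ '' UpsAndDowns.boundedMeasurable X ⊆
          UpsAndDowns.seqUp (UpsAndDowns.seqDown (range T))) ∧
        (UpsAndDowns.integral μ '' UpsAndDowns.boundedMeasurable X ⊆
          UpsAndDowns.seqDown (UpsAndDowns.seqUp (range T))) ∧
        (UpsAndDowns.L1EqBounded μ →
          UpsAndDowns.integral μ '' UpsAndDowns.boundedMeasurable X =
              UpsAndDowns.seqUp (UpsAndDowns.seqDown (range T)) ∧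
          UpsAndDowns.integral μ '' UpsAndDowns.boundedMeasurable X =
              UpsAndDowns.seqDown (UpsAndDowns.seqUp (range T)))) := by
  have hTm : Monotone T := monotone_of_nonneg hT
  have hTi : ∀ f : C_c(X, ℝ), HasSignedIntegral μ f (T f) := fun f =>
    (hrep f).2 ▸ hasSignedIntegral_of_mem_L1 hE (hrep f).1
  have hsub : boundedMeasurable X ⊆ L1 μ := boundedMeasurable_subset_L1 hE
  have hR := isConvexCone_range (T := T)
  have hDU : ∀ A, MeasurableSet A → μ.toFun A ∈ netDown (netUp (range T)) := fun A hA =>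
    toFun_mem_netDown_netUp hTm hopen (hreg.2 A hA)
  have hUD : ∀ A, MeasurableSet A → μ.toFun A ∈ netUp (netDown (range T)) := fun A hA =>
    toFun_mem_netUp_netDown hTm hcompact (hinner A hA)
  have hnegDU : -netDown (netUp (range T)) = netUp (netDown (range T)) := by
    rw [neg_netDown, neg_netUp, neg_range_linearMap]
  have hnegUD : -netUp (netDown (range T)) = netDown (netUp (range T)) := by
    rw [neg_netUp, neg_netDown, neg_range_linearMap]
  -- The integrals of bounded functions form a symmetric set, so any inclusion may be negated.
  have hneg : ∀ S : Set E, (integral μ '' boundedMeasurable X ⊆ S) →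
      integral μ '' boundedMeasurable X ⊆ -S := by
    rintro S hS _ ⟨f, hf, rfl⟩
    rw [Set.mem_neg, ← integral_neg hE (hsub hf)]
    exact hS ⟨_, neg_mem_boundedMeasurable hf, rfl⟩
  have h1 : integral μ '' boundedMeasurable X ⊆ seqUp (netDown (netUp (range T))) := by
    rintro _ ⟨f, hf, rfl⟩
    refine integral_mem_seqUp hE hR.netUp.netDown hDU ?_ hf
    -- The negative of the total mass lies in one cone because the total mass lies in the other.
    rw [← Set.mem_neg, hnegDU]
    exact hUD univ MeasurableSet.univ
  have h2 : integral μ '' boundedMeasurable X ⊆ seqUp (netUp (netDown (range T))) := by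
    rintro _ ⟨f, hf, rfl⟩
    refine integral_mem_seqUp hE hR.netDown.netUp hUD ?_ hf
    rw [← Set.mem_neg, hnegUD]
    exact hDU univ MeasurableSet.univ
  refine ⟨hsub, h1, ?_, h2, ?_, fun hC hL => ?_⟩
  · rw [← hnegDU, ← neg_seqUp]
    exact hneg _ h1
  · rw [← hnegUD, ← neg_seqUp]
    exact hneg _ h2
  have h3 : integral μ '' boundedMeasurable X ⊆ seqUp (seqDown (range T)) := by
    rintro _ ⟨f, hf, rfl⟩
    exact integral_mem_seqUp_seqDown hE hC hTm hTi (hopen univ isOpen_univ) hcompact hinner hf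
  have h4 : integral μ '' boundedMeasurable X ⊆ seqDown (seqUp (range T)) := by
    have h := hneg _ h3
    rwa [neg_seqUp, neg_seqDown, neg_range_linearMap] at h
  refine ⟨h3, h4, fun hB => ?_⟩
  have hTL : range T ⊆ integral μ '' L1 μ := by
    rintro _ ⟨f, rfl⟩
    exact ⟨f, (hrep f).1, (hrep f).2.symm⟩
  have hup := seqUp_integral_subset hE hL
  have hdown := seqDown_integral_subset hE hL
  have hLB := integral_L1_subset hE hB
  -- The range of `T` lies in the integrals of `L1 μ`, which are stable under both sequential
  -- operations and coincide with those of bounded functions.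
  exact ⟨h3.antisymm (((seqUp_mono ((seqDown_mono hTL).trans hdown)).trans hup).trans hLB),
    h4.antisymm (((seqDown_mono ((seqUp_mono hTL).trans hup)).trans hdown).trans hLB)⟩
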